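/- Let $\lambda$ be a cardinal which is the successor of an uncountable cardinal and satisfies $\lambda^{<\lambda}=\lambda$. Assume $2^\lambda=\lambda^+$ and Jensen's principle $\square_\lambda$: there is a sequence $\langle C_\alpha\mid\alpha<\lambda^+\rangle$ such that, for every $\alpha<\lambda^+$, $C_\alpha$ is a subset of $\alpha$ that is closed in $\alpha$, $\sup(C_\alpha)=\sup(\alpha)$, $\operatorname{otp}(C_\alpha)\le\lambda$, and for every $\beta\in C_\alpha$ with $\sup(C_\alpha\cap\beta)=\beta>0$ there is an ordinal $\varepsilon$ with $C_\beta=C_\alpha\cap\varepsilon$. Then there exists a full $\lambda^+$-Souslin tree. Here, for $\kappa=\lambda^+$, a $\kappa$-tree is a partially ordered set $(T,<_T)$ such that for every $x\in T$ the set $\{y\in T\mid y<_T x\}$ is well-ordered (its order type is the height of $x$), for every $\alpha<\kappa$ the set of nodes of height $\alpha$ is nonempty and of size less than $\kappa$, and there are no nodes of height $\kappa$. An $\alpha$-branch is a linearly ordered $B\subseteq T$ whose set of heights is exactly $\alpha$; it is vanishing if it has no upper bound in $T$. The tree is full if for every limit ordinal $\alpha<\kappa$ there is at most one vanishing $\alpha$-branch,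 and it is $\kappa$-Souslin if it has no $\kappa$-branches and no antichains (sets of pairwise incomparable nodes) of size $\kappa$. -/

import Mathlib

universe u

namespace FullSouslin

/-! ### Abstract transfinite trees -/

section Trees

variable (T : Type u) [PartialOrder T]

/-- A (transfinite) tree: a poset in which the strict predecessors of every node are
well-ordered. -/
class IsTree : Prop where
  isWellOrder_Iio : ∀ x : T, IsWellOrder (Set.Iio x) (· < ·)

variable {T}

/-- The height of a node: the order type of its set of strict predecessors. -/
noncomputable def height [h : IsTree T] (x : T) : Ordinal.{u} :=
  @Ordinal.type (Set.Iio x) (· < ·) (h.isWellOrder_Iio x)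

variable (T) [IsTree T]

/-- The `α`-th level of the tree. -/
def level (α : Ordinal.{u}) : Set T := {x | height x = α}

/-- The tree `T` is a `κ`-tree: for every `α < κ`, the `α`-th level is nonempty and of size less
than `κ`, and the `κ`-th level is empty. -/
structure IsKappaTree (κ : Cardinal.{u}) : Prop where
  level_nonempty : ∀ α < κ.ord, (level T α).Nonempty
  mk_level_lt : ∀ α < κ.ord, Cardinal.mk (level T α) < κ
  level_ord_eq_empty : level T κ.ord = ∅

variable {T}

/-- `B` is an `α`-branch: it is linearly ordered, and the set of heights of its nodes is exactly
the ordinal `α`, viewed as the set of smaller ordinals. -/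
def IsBranch (α : Ordinal.{u}) (B : Set T) : Prop :=
  IsChain (· ≤ ·) B ∧ height '' B = Set.Iio α

/-- A set of nodes is vanishing if it has no upper bound in the tree. -/
def IsVanishing (B : Set T) : Prop := ¬ ∃ y : T, ∀ x ∈ B, x ≤ y

variable (T)

/-- Fullness of a `κ`-tree: for every (nonzero) limit `α < κ`, at most one `α`-branch is
vanishing. -/
def IsFull (κ : Cardinal.{u}) : Prop :=
  ∀ α < κ.ord, Order.IsSuccLimit α →
    ∀ B B' : Set T, IsBranch α B → IsVanishing B → IsBranch α B' → IsVanishing B' → B = B'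

/-- A `κ`-tree is `κ`-Souslin if it has no `κ`-branches and no antichains of size `κ`. -/
structure IsSouslin (κ : Cardinal.{u}) : Prop where
  no_branch : ¬ ∃ B : Set T, IsBranch κ.ord B
  no_antichain : ¬ ∃ A : Set T, IsAntichain (· ≤ ·) A ∧ Cardinal.mk A = κ

end Trees

/-! ### Jensen's square principle -/

/-- The accumulation points of a set of ordinals `C` that belong to `C`. -/
def acc (C : Set Ordinal.{u}) : Set Ordinal.{u} :=
  {β ∈ C | sSup (C ∩ Set.Iio β) = β ∧ 0 < β}

/-- `C` is a `C`-sequence over `κ`: for all `α < κ`, the set `C α` is a subset of `α`, it is closed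
below `α`, and `sup (C α) = sup α`. -/
structure IsCSequence (κ : Cardinal.{u}) (C : Ordinal.{u} → Set Ordinal.{u}) : Prop where
  subset : ∀ α < κ.ord, C α ⊆ Set.Iio α
  closed : ∀ α < κ.ord, ∀ β < α, 0 < β → sSup (C α ∩ Set.Iio β) = β → β ∈ C α
  sSup_eq : ∀ α < κ.ord, sSup (C α) = sSup (Set.Iio α)

/-- `D` is an initial segment of `C`, of the form `C ∩ ε` for some ordinal `ε`. -/
def InitialSegment (D C : Set Ordinal.{u}) : Prop := ∃ ε : Ordinal.{u}, D = C ∩ Set.Iio ε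

/-- Jensen's principle `□_l`: there is a `C`-sequence over the successor cardinal of `l` whose
members have order type at most `l`, and which is coherent. (The order type of a set of ordinals
lives one universe up, hence the lift.) -/
def Square (l : Cardinal.{u}) : Prop :=
  ∃ C : Ordinal.{u} → Set Ordinal.{u},
    IsCSequence (Order.succ l) C ∧
    (∀ α < (Order.succ l).ord,
      Ordinal.type (α := C α) (· < ·) ≤ Ordinal.lift.{u + 1} l.ord) ∧
    (∀ α < (Order.succ l).ord, ∀ β < α, β ∈ acc (C α) → InitialSegment (C β) (C α))

end FullSouslin

/-! Write λ = μ⁺. Nodes of level α are subsets of α, ordered by end-extension, and successor levels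
split in all ways. What matters is which cofinal branches receive a node at a limit level, and two
ladder systems govern this.

Along a tail-coherent ladder `c`, a branch is protected if from some point on it passes each step b
< β of consecutive ladder points by a fixed canonical extension (`next`). Tail coherence lets
canonical construction survive limit levels (`exists_canonical`), so every node extends to all
higher levels. Along the square ladder `C`, a diamond guesses a branch; at cofinality other than λ
every branch gets a node except possibly the guessed one. Since codes are injective on levels and `C
α` is cofinal in α, at most one branch is guessed, which is fullness (`branch_unique`).

The key point is cofinality λ. An unprotected branch there deviates from the canonical extensions
cofinally often; `exists_local_diamond` yields a smaller limit δ of deviations at which the same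
branch is guessed, so its restriction to δ could not have been a node. Hence every branch at
cofinality λ is protected (`isProtected_of_cof_eq`). So nothing is omitted there, and a branch is
determined by a tail start and a node at that level; with λ^{<λ} = λ at other cofinalities, levels
have size at most λ (`exists_injOn_lvl`).

For antichains, `exists_guessing_tailLadder` supplies a γ of cofinality λ whose ladder has cofinally
many successor points β at which a given maximal antichain is guessed below β. Canonical extensions
meet the guessed set whenever possible, and all branches at γ are protected, so the antichain lies
below γ (`exists_sealed`). A cofinal branch would give an antichain of size λ⁺ of nodes leaving it.

The guesses rest on Shelah's theorem (`exists_diamond`): 2^ν = ν⁺ implies diamond on every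
stationary set of ordinals below ν⁺ of cofinality different from cf ν. It is used on λ = μ⁺ and on
λ⁺. -/

namespace FullSouslin

open Order Cardinal

/-! ### Accumulation points and clubs -/

/-- The set `A` is unbounded below the nonzero ordinal `τ`. -/
def UnbddBelow (A : Set Ordinal.{u}) (τ : Ordinal.{u}) : Prop :=
  0 < τ ∧ ∀ x < τ, ∃ y ∈ A, x < y ∧ y < τ

/-- The set `D` is closed and unbounded below `K`. -/
structure ClubIn (D : Set Ordinal.{u}) (K : Ordinal.{u}) : Prop where
  unbdd : UnbddBelow D K
  closed : ∀ τ < K, UnbddBelow D τ → τ ∈ D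

theorem UnbddBelow.isSuccLimit {A : Set Ordinal.{u}} {τ : Ordinal.{u}} (h : UnbddBelow A τ) :
    IsSuccLimit τ := by
  refine ⟨fun hm => ?_, fun x hx => ?_⟩
  · exact absurd (hm.eq_bot) h.1.ne'
  · obtain ⟨y, -, hxy, hy⟩ := h.2 x hx.lt
    exact hx.2 hxy hy

theorem UnbddBelow.mono {A B : Set Ordinal.{u}} {τ : Ordinal.{u}} (h : UnbddBelow A τ)
    (hAB : ∀ x ∈ A, x < τ → x ∈ B) : UnbddBelow B τ :=
  ⟨h.1, fun x hx => by obtain ⟨y, hy, h1, h2⟩ := h.2 x hx; exact ⟨y, hAB y hy h2, h1, h2⟩⟩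

theorem UnbddBelow.above {A : Set Ordinal.{u}} {τ a : Ordinal.{u}} (h : UnbddBelow A τ)
    (ha : a < τ) : UnbddBelow (A ∩ Set.Ioi a) τ :=
  ⟨h.1, fun x hx => by
    obtain ⟨y, hy, h1, h2⟩ := h.2 (max x a) (max_lt hx ha)
    exact ⟨y, ⟨hy, (le_max_right _ _).trans_lt h1⟩, (le_max_left _ _).trans_lt h1, h2⟩⟩

theorem not_unbddBelow {A : Set Ordinal.{u}} {τ : Ordinal.{u}} (h : ¬ UnbddBelow A τ)
    (h0 : 0 < τ) : ∃ x < τ, ∀ y ∈ A, x < y → τ ≤ y := by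
  simp only [UnbddBelow, not_and, not_forall, not_exists, not_lt] at h
  obtain ⟨x, hx, h⟩ := h h0
  exact ⟨x, hx, h⟩

theorem unbddBelow_of_isSuccLimit {τ : Ordinal.{u}} (h : IsSuccLimit τ) :
    UnbddBelow Set.univ τ :=
  ⟨h.bot_lt, fun x hx => ⟨succ x, trivial, lt_succ x, h.succ_lt hx⟩⟩

theorem UnbddBelow.of_limit_points {A : Set Ordinal.{u}} {τ : Ordinal.{u}}
    (h : UnbddBelow {σ | UnbddBelow A σ} τ) : UnbddBelow A τ :=
  ⟨h.1, fun x hx => by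
    obtain ⟨σ, hσ, h1, h2⟩ := h.2 x hx
    obtain ⟨y, hy, h3, h4⟩ := hσ.2 x h1
    exact ⟨y, hy, h3, h4.trans h2⟩⟩

theorem sSup_inter_Iio_eq_iff {A : Set Ordinal.{u}} {τ : Ordinal.{u}} :
    (sSup (A ∩ Set.Iio τ) = τ ∧ 0 < τ) ↔ UnbddBelow A τ := by
  have hb : BddAbove (A ∩ Set.Iio τ) := ⟨τ, fun x hx => le_of_lt hx.2⟩
  constructor
  · rintro ⟨h, h0⟩
    refine ⟨h0, fun x hx => ?_⟩
    by_contra hc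
    push Not at hc
    have : sSup (A ∩ Set.Iio τ) ≤ x := csSup_le' fun y hy => by
      by_contra hxy
      exact absurd hy.2 (not_lt.2 (hc y hy.1 (not_le.1 hxy)))
    exact absurd hx (not_lt.2 (h ▸ this))
  · intro h
    refine ⟨le_antisymm (csSup_le' fun y hy => le_of_lt hy.2) ?_, h.1⟩
    by_contra hc
    obtain ⟨y, hy, h1, h2⟩ := h.2 _ (not_le.1 hc)
    exact absurd (le_csSup hb ⟨hy, h2⟩) (not_le.2 h1)

/-! ### Bounding families of ordinals -/

theorem exists_bound {ι : Type u} {γ : Ordinal.{u}} (f : ι → Ordinal.{u}) (h : #ι < γ.cof)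
    (hf : ∀ i, f i < γ) : ∃ b < γ, ∀ i, f i ≤ b :=
  ⟨⨆ i, f i, Ordinal.iSup_lt_of_lt_cof h hf, fun i => Ordinal.le_iSup f i⟩

theorem exists_bound_nat {γ : Ordinal.{u}} (f : ℕ → Ordinal.{u}) (h : ℵ₀ < γ.cof)
    (hf : ∀ i, f i < γ) : ∃ b < γ, ∀ i, f i ≤ b := by
  obtain ⟨b, hb, h⟩ := exists_bound (fun i : ULift.{u} ℕ => f i.down) (by simpa using h)
    fun i => hf _
  exact ⟨b, hb, fun i => h ⟨i⟩⟩

theorem exists_bound_Iio {γ o : Ordinal.{u}} (f : Ordinal.{u} → Ordinal.{u}) (h : o.card < γ.cof)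
    (hf : ∀ i < o, f i < γ) : ∃ b < γ, ∀ i < o, f i ≤ b := by
  obtain ⟨b, hb, h⟩ := exists_bound (fun i : o.ToType => f (Ordinal.ToType.mk.symm i))
    (by simpa using h) fun i => hf _ (Ordinal.ToType.mk.symm i).2
  exact ⟨b, hb, fun i hi => by simpa using h (Ordinal.ToType.mk ⟨i, hi⟩)⟩

theorem card_lt_cof {κ : Cardinal.{u}} (hκ : κ.IsRegular) {o : Ordinal.{u}} (ho : o < κ.ord) :
    o.card < κ.ord.cof := by
  rw [hκ.cof_ord]; exact lt_ord.1 ho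

section Regular

variable {κ : Cardinal.{u}}

theorem isSuccLimit_ord_of_isRegular (hκ : κ.IsRegular) : IsSuccLimit κ.ord :=
  Cardinal.isSuccLimit_ord hκ.aleph0_le

theorem exists_closure_point (hκ : κ.IsRegular) (h0 : ℵ₀ < κ) (g : Ordinal.{u} → Ordinal.{u})
    (hg : ∀ x < κ.ord, g x < κ.ord) {x : Ordinal.{u}} (hx : x < κ.ord) :
    ∃ τ < κ.ord, x < τ ∧ IsSuccLimit τ ∧ ∀ y < τ, g y < τ := by
  have hlim := isSuccLimit_ord_of_isRegular hκ
  have key : ∀ a : Set.Iio κ.ord, ∃ b : Set.Iio κ.ord, a.1 < b.1 ∧ ∀ y ≤ a.1, g y < b.1 := by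
    rintro ⟨a, ha⟩
    obtain ⟨b, hb, h⟩ := exists_bound_Iio (o := succ a) g (card_lt_cof hκ (hlim.succ_lt ha))
      (fun i hi => hg i ((le_of_lt_succ hi).trans_lt ha))
    refine ⟨⟨succ (max a b), hlim.succ_lt (max_lt ha hb)⟩, lt_succ_of_le (le_max_left _ _), ?_⟩
    intro y hy
    exact lt_succ_of_le ((h y (lt_succ_of_le hy)).trans (le_max_right _ _))
  choose F hF1 hF2 using key
  let s : ℕ → Set.Iio κ.ord := fun n => F^[n] ⟨x, hx⟩
  have hs : ∀ n, s (n + 1) = F (s n) := fun n => Function.iterate_succ_apply' F n _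
  obtain ⟨b, hb, h⟩ := exists_bound_nat (γ := κ.ord) (fun n => (s n).1) (by rwa [hκ.cof_ord])
    fun n => (s n).2
  have hbd : BddAbove (Set.range fun n => (s n).1) := ⟨b, by rintro _ ⟨n, rfl⟩; exact h n⟩
  have hlt : ∀ n, (s n).1 < ⨆ n, (s n).1 := fun n =>
    lt_of_lt_of_le (by rw [hs]; exact hF1 _ : (s n).1 < (s (n + 1)).1) (le_ciSup hbd (n + 1))
  have hex : ∀ y < ⨆ n, (s n).1, ∃ n, y < (s n).1 := fun y hy => exists_lt_of_lt_ciSup hy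
  refine ⟨⨆ n, (s n).1, (ciSup_le' h).trans_lt hb, hlt 0, ?_, ?_⟩
  · have : UnbddBelow Set.univ (⨆ n, (s n).1) := ⟨(zero_le).trans_lt (hlt 0), fun y hy => by
      obtain ⟨n, hn⟩ := hex y hy
      exact ⟨_, trivial, hn, hlt n⟩⟩
    exact this.isSuccLimit
  · intro y hy
    obtain ⟨n, hn⟩ := hex y hy
    have := hF2 (s n) y hn.le
    rw [← hs] at this
    exact this.trans (hlt _)

theorem clubIn_closure_points (hκ : κ.IsRegular) (h0 : ℵ₀ < κ) (g : Ordinal.{u} → Ordinal.{u})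
    (hg : ∀ x < κ.ord, g x < κ.ord) : ClubIn {τ | IsSuccLimit τ ∧ ∀ y < τ, g y < τ} κ.ord := by
  refine ⟨⟨hκ.ord_pos, fun x hx => ?_⟩, fun τ hτ h => ⟨h.isSuccLimit, fun y hy => ?_⟩⟩
  · obtain ⟨τ, h1, h2, h3⟩ := exists_closure_point hκ h0 g hg hx
    exact ⟨τ, h3, h2, h1⟩
  · obtain ⟨z, hz, h1, h2⟩ := h.2 y hy
    exact (hz.2 y h1).trans h2

/-- Limit points of an unbounded set form a club. -/
theorem UnbddBelow.clubIn (hκ : κ.IsRegular) (h0 : ℵ₀ < κ) {V : Set Ordinal.{u}}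
    (hV : UnbddBelow V κ.ord) : ClubIn {τ | UnbddBelow V τ} κ.ord := by
  refine ⟨⟨hκ.ord_pos, fun x hx => ?_⟩, fun τ hτ h => h.of_limit_points⟩
  choose! g hg1 hg2 hg3 using hV.2
  obtain ⟨τ, h1, h2, h3, h4⟩ := exists_closure_point hκ h0 g hg3 hx
  exact ⟨τ, ⟨h3.bot_lt, fun y hy => ⟨g y, hg1 y (hy.trans h1), hg2 y (hy.trans h1), h4 y hy⟩⟩,
    h2, h1⟩

theorem ClubIn.iInter (hκ : κ.IsRegular) (h0 : ℵ₀ < κ) {ι : Type u} (hι : #ι < κ)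
    {D : ι → Set Ordinal.{u}} (hD : ∀ i, ClubIn (D i) κ.ord) : ClubIn (⋂ i, D i) κ.ord := by
  refine ⟨⟨hκ.ord_pos, fun x hx => ?_⟩, fun τ hτ h => ?_⟩
  · have : ∀ y < κ.ord, ∃ b < κ.ord, ∀ i, ∃ z ∈ D i, y < z ∧ z ≤ b := by
      intro y hy
      choose f hf1 hf2 hf3 using fun i => (hD i).unbdd.2 y hy
      obtain ⟨b, hb, h⟩ := exists_bound f (by rwa [hκ.cof_ord]) hf3
      exact ⟨b, hb, fun i => ⟨f i, hf1 i, hf2 i, h i⟩⟩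
    choose! g hg1 hg2 using this
    obtain ⟨τ, h1, h2, h3, h4⟩ := exists_closure_point hκ h0 g hg1 hx
    refine ⟨τ, ?_, h2, h1⟩
    rw [Set.mem_iInter]
    intro i
    refine (hD i).closed τ h1 ⟨h3.bot_lt, fun y hy => ?_⟩
    obtain ⟨z, hz, h5, h6⟩ := hg2 y (hy.trans h1) i
    exact ⟨z, hz, h5, h6.trans_lt (h4 y hy)⟩
  · rw [Set.mem_iInter]
    exact fun i => (hD i).closed τ hτ (h.mono fun x hx _ => Set.mem_iInter.1 hx i)

theorem ClubIn.iInter_nat (hκ : κ.IsRegular) (h0 : ℵ₀ < κ)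
    {D : ℕ → Set Ordinal.{u}} (hD : ∀ i, ClubIn (D i) κ.ord) : ClubIn (⋂ i, D i) κ.ord := by
  have := ClubIn.iInter hκ h0 (ι := ULift.{u} ℕ) (by simpa using h0) (D := fun i => D i.down)
    fun i => hD _
  convert! this using 1
  ext x; simp

theorem ClubIn.inter (hκ : κ.IsRegular) (h0 : ℵ₀ < κ) {D E : Set Ordinal.{u}}
    (hD : ClubIn D κ.ord) (hE : ClubIn E κ.ord) : ClubIn (D ∩ E) κ.ord := by
  have := ClubIn.iInter hκ h0 (ι := ULift.{u} Bool)
    (by simpa using (Cardinal.natCast_lt_aleph0 (n := 2)).trans h0)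
    (D := fun i => if i.down then D else E) fun i => by split <;> assumption
  convert! this using 1
  ext x; simp [and_comm]

/-- A club of a regular cardinal contains points of any smaller regular cofinality, which moreover
are limits of the club. -/
theorem ClubIn.exists_cof (hκ : κ.IsRegular) {D : Set Ordinal.{u}} (hD : ClubIn D κ.ord)
    {θ : Cardinal.{u}} (hθ : θ.IsRegular) (hlt : θ < κ) :
    ∃ τ ∈ D, τ < κ.ord ∧ τ.cof = θ ∧ UnbddBelow D τ := by
  have hlim := isSuccLimit_ord_of_isRegular hκ
  choose! n hn1 hn2 hn3 using hD.unbdd.2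
  -- Each value is a point of `D` above the supremum of the earlier ones; since θ < κ, the first θ
  -- values stay below κ, and strict monotonicity gives their supremum cofinality θ.
  let f : Ordinal.{u} → Ordinal.{u} := WellFounded.fix (C := fun _ => Ordinal.{u})
    (wellFounded_lt (α := Ordinal.{u})) fun i f => n (⨆ j : Set.Iio i, f j.1 j.2)
  have hf : ∀ i, f i = n (⨆ j : Set.Iio i, f j.1) := fun i => WellFounded.fix_eq _ _ _
  have hb : ∀ i, BddAbove (Set.range fun j : Set.Iio i => f j.1) := fun i =>
    Ordinal.bddAbove_of_small
  have hlt1 : ∀ i < θ.ord, f i < κ.ord ∧ (⨆ j : Set.Iio i, f j.1) < κ.ord := by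
    intro i
    induction i using WellFoundedLT.induction with
    | ind i ih =>
      intro hi
      obtain ⟨b, hb', h⟩ := exists_bound_Iio (γ := κ.ord) (o := i) f
        (card_lt_cof hκ (hi.trans (ord_lt_ord.2 hlt))) (fun j hj => (ih j hj (hj.trans hi)).1)
      have h2 : (⨆ j : Set.Iio i, f j.1) < κ.ord := (ciSup_le' fun j : Set.Iio i => h j.1 j.2).trans_lt hb'
      exact ⟨by rw [hf]; exact hn3 _ h2, h2⟩
  have hmono : ∀ i < θ.ord, ∀ j < i, f j < f i := by
    intro i hi j hj
    rw [hf i]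
    exact (le_ciSup (hb i) ⟨j, hj⟩).trans_lt (hn2 _ (hlt1 i hi).2)
  have hmem : ∀ i < θ.ord, f i ∈ D := fun i hi => by rw [hf i]; exact hn1 _ (hlt1 i hi).2
  let F : Set.Iio θ.ord → Ordinal.{u} := fun i => f i.1
  have hF : StrictMono F := fun i j h => hmono j.1 j.2 i.1 h
  have hθlim := isSuccLimit_ord_of_isRegular hθ
  have hcof := Ordinal.cof_iSup_Iio hF hθlim.isSuccPrelimit
  rw [hθ.cof_ord] at hcof
  have hbd := hb θ.ord
  have hlt2 : ∀ i : Set.Iio θ.ord, F i < ⨆ i, F i := fun i =>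
    (hF (show i < ⟨succ i.1, hθlim.succ_lt i.2⟩ from lt_succ i.1)).trans_le (le_ciSup hbd _)
  have hU : UnbddBelow D (⨆ i, F i) :=
    ⟨(zero_le).trans_lt (hlt2 ⟨0, hθ.ord_pos⟩), fun x hx => by
      obtain ⟨i, hi⟩ := exists_lt_of_lt_ciSup' hx
      exact ⟨F i, hmem _ i.2, hi, hlt2 i⟩⟩
  have hK : (⨆ i, F i) < κ.ord := by
    obtain ⟨b, hb', h⟩ := exists_bound_Iio (γ := κ.ord) (o := θ.ord) f
      (card_lt_cof hκ (ord_lt_ord.2 hlt)) (fun j hj => (hlt1 j hj).1)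
    exact (ciSup_le' fun j : Set.Iio θ.ord => h j.1 j.2).trans_lt hb'
  exact ⟨_, hD.closed _ hK hU, hK, hcof, hU⟩

end Regular

/-! ### Shelah's diamond -/

/-- The ordinal represented by an element of `o.ToType`. -/
noncomputable def toOrd {o : Ordinal.{u}} (a : o.ToType) : Ordinal.{u} :=
  (Ordinal.ToType.mk.symm a).1

/-- The element of `o.ToType` representing an ordinal below `o`. -/
noncomputable def ofOrd {o : Ordinal.{u}} (x : Ordinal.{u}) (hx : x < o) : o.ToType :=
  Ordinal.ToType.mk ⟨x, hx⟩

theorem toOrd_lt {o : Ordinal.{u}} (a : o.ToType) : toOrd a < o := (Ordinal.ToType.mk.symm a).2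

@[simp] theorem toOrd_ofOrd {o : Ordinal.{u}} (x : Ordinal.{u}) (hx : x < o) :
    toOrd (ofOrd x hx) = x := by simp [toOrd, ofOrd]

@[simp] theorem ofOrd_toOrd {o : Ordinal.{u}} (a : o.ToType) (h : toOrd a < o) :
    ofOrd (toOrd a) h = a := by simp [toOrd, ofOrd]

theorem toOrd_injective {o : Ordinal.{u}} : Function.Injective (toOrd (o := o)) := fun _ _ h =>
  Ordinal.ToType.mk.symm.injective (Subtype.ext h)

/-- Enumeration of all matrices of bounded functions. -/
theorem exists_enumeration {ν : Cardinal.{u}} (hν : ℵ₀ ≤ ν) (hpow : (2 : Cardinal.{u}) ^ ν = succ ν)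
    {Y : Type u} [Nonempty Y] (hY : #Y ≤ 2 ^ ν) :
    ∃ X : Ordinal.{u} → Ordinal.{u} → Ordinal.{u} → Ordinal.{u} → Y,
      ∀ Z : Ordinal.{u} → Ordinal.{u} → Ordinal.{u} → Y, ∀ α < (succ ν).ord,
        ∃ ξ < (succ ν).ord, ∀ i < ν.ord, ∀ η < ν.ord, ∀ x < α, X ξ i η x = Z i η x := by
  classical
  let N := ν.ord.ToType
  let F := Σ α : (succ ν).ord.ToType,
    (N → N → (toOrd α).ToType → Y)
  -- For each fixed α of size at most ν there are at most ((2^ν)^ν)^ν)^ν = 2^ν = ν⁺ matrices, and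
  -- there are ν⁺ values of α.
  have hF : #F ≤ #(succ ν).ord.ToType := by
    have h1 : ∀ α : (succ ν).ord.ToType,
        #(N → N → (toOrd α).ToType → Y) ≤ 2 ^ ν := by
      intro α
      have hα : (toOrd α).card ≤ ν :=
        lt_succ_iff.1 (lt_ord.1 (toOrd_lt α))
      have h0 : (2 : Cardinal.{u}) ^ ν ≠ 0 := by rw [hpow]; exact succ_ne_zero ν
      simp only [mk_pi, prod_const, lift_id, N, mk_toType, card_ord]
      calc ((#Y ^ (toOrd α).card) ^ ν) ^ ν ≤ (((2 ^ ν) ^ ν) ^ ν) ^ ν := by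
            refine power_le_power_right (power_le_power_right ?_)
            exact (power_le_power_right hY).trans (Cardinal.power_le_power_left h0 hα)
        _ = 2 ^ ν := by simp only [← power_mul, mul_eq_self hν]
    rw [mk_sigma]
    calc sum _ ≤ sum fun _ : (succ ν).ord.ToType => (2 : Cardinal.{u}) ^ ν := sum_le_sum _ _ h1
      _ ≤ _ := by
        rw [sum_const, hpow, lift_id, lift_id, mk_toType, card_ord]
        exact (mul_eq_self (hν.trans (le_succ ν))).le
  obtain ⟨e⟩ := hF
  have hex : ∀ ξ : Ordinal.{u}, ∃ G : Ordinal.{u} → Ordinal.{u} → Ordinal.{u} → Y,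
      ∀ p : F, (toOrd (e p)) = ξ → ∀ i η : N,
        ∀ x : (toOrd p.1).ToType,
        G (toOrd i) (toOrd η) (toOrd x)
          = p.2 i η x := by
    intro ξ
    by_cases h : ∃ p : F, (toOrd (e p)) = ξ
    · obtain ⟨p, rfl⟩ := h
      refine ⟨fun i η x => if h : i < ν.ord ∧ η < ν.ord ∧ x < (toOrd p.1) then
        p.2 (ofOrd i (h.1)) (ofOrd η (h.2.1))
          (ofOrd x (h.2.2)) else Classical.arbitrary Y, ?_⟩
      intro q hq i η x
      have hqp : q = p := e.injective (toOrd_injective hq)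
      subst hqp
      have hc := And.intro (toOrd_lt i)
        (And.intro (toOrd_lt η) (toOrd_lt x))
      simp only [dif_pos hc, ofOrd_toOrd]
    · exact ⟨fun _ _ _ => Classical.arbitrary Y, fun p hp => absurd ⟨p, hp⟩ h⟩
  choose X hX using hex
  refine ⟨X, fun Z α hα => ?_⟩
  let p : F := ⟨ofOrd α (hα), fun i η x => Z (toOrd i)
    (toOrd η) (toOrd x)⟩
  refine ⟨(toOrd (e p)), toOrd_lt _,
    fun i hi η hη x hx => ?_⟩
  have := hX _ p rfl (ofOrd i (hi)) (ofOrd η (hη))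
    (ofOrd x (by simpa [p] using hx))
  simpa [p] using this

theorem exists_enum_pairs {ν : Cardinal.{u}} (hν : ℵ₀ ≤ ν) {δ : Ordinal.{u}}
    (hδ : δ < (succ ν).ord) : ∃ σ : Ordinal.{u} → Ordinal.{u} × Ordinal.{u},
      ∀ α < δ, ∀ ξ < δ, ∃ p < ν.ord, σ p = (α, ξ) := by
  classical
  have hc : #(δ.ToType × δ.ToType) ≤ #ν.ord.ToType := by
    have : δ.card ≤ ν := lt_succ_iff.1 (lt_ord.1 hδ)
    simp only [mk_prod, lift_id, mk_toType, card_ord]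
    exact (mul_le_mul' this this).trans (mul_eq_self hν).le
  obtain ⟨e⟩ := hc
  have hex : ∀ p : Ordinal.{u}, ∃ r : Ordinal.{u} × Ordinal.{u}, ∀ a : δ.ToType × δ.ToType,
      toOrd (e a) = p →
      r = (toOrd a.1, toOrd a.2) := by
    intro p
    by_cases h : ∃ a : δ.ToType × δ.ToType, toOrd (e a) = p
    · obtain ⟨a, rfl⟩ := h
      refine ⟨(toOrd a.1, toOrd a.2), fun b hb => ?_⟩
      rw [e.injective (toOrd_injective hb)]
    · exact ⟨(0, 0), fun a ha => absurd ⟨a, ha⟩ h⟩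
  choose σ hσ using hex
  refine ⟨σ, fun α hα ξ hξ => ⟨_, toOrd_lt (e (ofOrd α hα, ofOrd ξ hξ)), ?_⟩⟩
  rw [hσ _ _ rfl]
  simp

/-- A function from `δ` to `o` is bounded on an unbounded set when the cofinalities differ. -/
theorem exists_bounded_on_unbounded {δ o : Ordinal.{u}} (hδ : IsSuccLimit δ) (ho : IsSuccLimit o)
    (hne : δ.cof ≠ o.cof) (r : Ordinal.{u} → Ordinal.{u}) (hr : ∀ α < δ, r α < o) :
    ∃ b < o, UnbddBelow {α | r α < b} δ := by
  obtain ⟨s, hs, hsc⟩ := Order.exists_cof_eq δ.ToType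
  obtain ⟨t, ht, htc⟩ := Order.exists_cof_eq o.ToType
  rw [Ordinal.cof_toType] at hsc htc
  rcases lt_or_gt_of_ne hne with h | h
  · obtain ⟨b, hb, hbd⟩ := exists_bound (γ := o)
      (fun x : s => r (toOrd x.1)) (by rwa [hsc])
      (fun x => hr _ (toOrd_lt x.1))
    refine ⟨succ b, ho.succ_lt hb, hδ.bot_lt, fun x hx => ?_⟩
    obtain ⟨y, hy, hxy⟩ := hs (Ordinal.ToType.mk ⟨succ x, hδ.succ_lt hx⟩)
    refine ⟨(toOrd y), lt_succ_of_le (hbd ⟨y, hy⟩), ?_,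
      (toOrd_lt y)⟩
    have h2 : (⟨succ x, hδ.succ_lt hx⟩ : Set.Iio δ) ≤ Ordinal.ToType.mk.symm y := by
      rwa [OrderIso.le_symm_apply]
    exact (lt_succ x).trans_le h2
  · by_contra hc
    push Not at hc
    have : ∀ b < o, ∃ x < δ, ∀ y < δ, x < y → b ≤ r y := by
      intro b hb
      obtain ⟨x, hx, h⟩ := not_unbddBelow (hc b hb) hδ.bot_lt
      refine ⟨x, hx, fun y hy hxy => ?_⟩
      by_contra hlt
      exact absurd (h y (not_le.1 hlt) hxy) (not_le.2 hy)
    choose! g hg1 hg2 using this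
    obtain ⟨b, hb, hbd⟩ := exists_bound (γ := δ)
      (fun x : t => g (toOrd x.1)) (by rwa [htc])
      (fun x => hg1 _ (toOrd_lt x.1))
    have hb1 := hδ.succ_lt hb
    have hr1 := ho.succ_lt (hr _ hb1)
    obtain ⟨y, hy, hxy⟩ := ht (Ordinal.ToType.mk ⟨_, hr1⟩)
    have h2 : (⟨_, hr1⟩ : Set.Iio o) ≤ Ordinal.ToType.mk.symm y := by
      rwa [OrderIso.le_symm_apply]
    have h3 := hg2 _ (toOrd_lt y) (succ b) hb1
      (lt_succ_of_le (hbd ⟨y, hy⟩))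
    have h4 : succ (r (succ b)) ≤ (toOrd y) := h2
    exact absurd (h4.trans h3) (not_le.2 (lt_succ _))

/-- Shelah's argument. Matrices with ν blocks of ν rows are enumerated in type ν⁺, and each δ
carries ν candidates for the restriction of a matrix. If every guessing procedure fails, a matrix
`Z` is built by recursion on rows: row η of block i is a counterexample to the guess computed from
the candidates with index below i that agree with the earlier rows. At a suitable δ each row must
eliminate one of the fewer than ν candidates, which is impossible ν times. -/
theorem exists_diamond {ν : Cardinal.{u}} (hν : ℵ₀ ≤ ν) (hpow : (2 : Cardinal.{u}) ^ ν = succ ν)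
    {S : Set Ordinal.{u}} (hS : ∀ D, ClubIn D (succ ν).ord → ∃ δ ∈ S, δ ∈ D ∧ δ < (succ ν).ord)
    (hcof : ∀ δ ∈ S, δ.cof ≠ ν.ord.cof) {Y : Type u} [Nonempty Y] (hY : #Y ≤ 2 ^ ν) :
    ∃ d : Ordinal.{u} → Ordinal.{u} → Y, ∀ f : Ordinal.{u} → Y, ∀ D, ClubIn D (succ ν).ord →
      ∃ δ ∈ S, δ ∈ D ∧ δ < (succ ν).ord ∧ ∀ x < δ, d δ x = f x := by
  classical
  have hκ : (succ ν).IsRegular := isRegular_succ hν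
  have hκ0 : ℵ₀ < succ ν := hν.trans_lt (lt_succ ν)
  by_contra hfail
  push Not at hfail
  choose badf badD hbadD hbad using hfail
  obtain ⟨X, hX⟩ := exists_enumeration hν hpow hY
  have hσ : ∀ δ : Ordinal.{u}, ∃ σ : Ordinal.{u} → Ordinal.{u} × Ordinal.{u},
      δ < (succ ν).ord → ∀ α < δ, ∀ ξ < δ, ∃ p < ν.ord, σ p = (α, ξ) := by
    intro δ
    by_cases h : δ < (succ ν).ord
    · obtain ⟨σ, h⟩ := exists_enum_pairs hν h; exact ⟨σ, fun _ => h⟩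
    · exact ⟨fun _ => (0, 0), fun h' => absurd h' h⟩
  choose σ hσ using hσ
  -- The candidates with index below `i` that survive comparison with the rows `z` before η; `guess`
  -- reads row η off any survivor long enough.
  let V (i η : Ordinal.{u}) (z : ∀ τ < η, Ordinal.{u} → Y) (δ : Ordinal.{u}) : Set Ordinal.{u} :=
    {p | p < i ∧ ∀ τ, ∀ h : τ < η, ∀ x < (σ δ p).1, X (σ δ p).2 i τ x = z τ h x}
  let guess (i η : Ordinal.{u}) (z : ∀ τ < η, Ordinal.{u} → Y) : Ordinal.{u} → Ordinal.{u} → Y :=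
    fun δ x => if h : ∃ p ∈ V i η z δ, x < (σ δ p).1 then X (σ δ h.choose).2 i η x
      else Classical.arbitrary Y
  let Z (i : Ordinal.{u}) : Ordinal.{u} → Ordinal.{u} → Y :=
    WellFounded.fix (C := fun _ => Ordinal.{u} → Y) (wellFounded_lt (α := Ordinal.{u}))
      fun η z => badf (guess i η z)
  have hZ : ∀ i η, Z i η = badf (guess i η fun τ _ => Z i τ) := fun i η =>
    WellFounded.fix_eq _ _ _
  choose! h hh1 hh2 using hX Z
  let N := ν.ord.ToType
  let o (a : N) : Ordinal.{u} := (toOrd a)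
  have hclub := (ClubIn.iInter hκ hκ0 (ι := N × N)
    (by simp [N, mul_eq_self hν])
    (D := fun a => badD (guess (o a.1) (o a.2) fun τ _ => Z (o a.1) τ)) fun a => hbadD _).inter
    hκ hκ0 (clubIn_closure_points hκ hκ0 h hh1)
  obtain ⟨δ, hδS, ⟨hδ1, hδlim, hδ2⟩, hδ3⟩ := hS _ hclub
  have hp : ∀ α < δ, ∃ p < ν.ord, σ δ p = (α, h α) := fun α hα => hσ δ hδ3 α hα _ (hδ2 α hα)
  choose! p hp1 hp2 using hp
  -- Here the cofinality hypothesis enters: true restrictions of `Z`, of cofinally many lengths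
  -- below δ, have indices below one fixed `i`, so survivors always cover δ.
  obtain ⟨i, hi, hunb⟩ := exists_bounded_on_unbounded hδlim (isSuccLimit_ord hν) (hcof δ hδS) p hp1
  -- If no survivor were eliminated by row η, all would agree with `Z i η`, so the guess would be
  -- right below δ, contradicting the choice of row η.
  have hstep : ∀ η < ν.ord, ∃ q, q ∈ V i η (fun τ _ => Z i τ) δ ∧
      q ∉ V i (succ η) (fun τ _ => Z i τ) δ := by
    intro η hη
    by_contra hc
    push Not at hc
    have hmem : δ ∈ badD (guess i η fun τ _ => Z i τ) := by
      have := Set.mem_iInter.1 hδ1 (ofOrd i hi, ofOrd η hη)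
      have key : ∀ i' η', i' = i → η' = η → δ ∈ badD (guess i' η' fun τ _ => Z i' τ) →
          δ ∈ badD (guess i η fun τ _ => Z i τ) := by
        rintro _ _ rfl rfl h; exact h
      exact key _ _ (toOrd_ofOrd i hi) (toOrd_ofOrd η hη) this
    obtain ⟨x, hx, hne⟩ := hbad _ δ hδS hmem hδ3
    apply hne
    rw [← hZ]
    obtain ⟨α, hα1, hα2, hα3⟩ := hunb.2 x hx
    have hex : ∃ q ∈ V i η (fun τ _ => Z i τ) δ, x < (σ δ q).1 := by
      refine ⟨p α, ⟨hα1, fun τ hτ y hy => ?_⟩, by rw [hp2 α hα3]; exact hα2⟩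
      rw [hp2 α hα3] at hy ⊢
      exact hh2 α (hα3.trans hδ3) i hi τ (hτ.trans hη) y hy
    have : guess i η (fun τ _ => Z i τ) δ x = X (σ δ hex.choose).2 i η x := dif_pos hex
    rw [this]
    exact (hc _ hex.choose_spec.1).2 η (lt_succ η) x hex.choose_spec.2
  choose! q hq1 hq2 using hstep
  have hinj : Set.InjOn q (Set.Iio ν.ord) := by
    have key : ∀ a < ν.ord, ∀ b < ν.ord, a < b → q a ≠ q b := by
      intro a ha b hb hab heq
      apply hq2 a ha
      rw [heq]
      exact ⟨(hq1 b hb).1, fun τ hτ => (hq1 b hb).2 τ ((le_of_lt_succ hτ).trans_lt hab)⟩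
    intro a ha b hb heq
    by_contra hne
    rcases lt_or_gt_of_ne hne with h | h
    · exact key a ha b hb h heq
    · exact key b hb a ha h heq.symm
  have hle : #(Set.Iio ν.ord) ≤ #(Set.Iio i) :=
    mk_le_of_injective (f := fun a : Set.Iio ν.ord => (⟨q a.1, (hq1 a.1 a.2).1⟩ : Set.Iio i))
      fun a b hab => Subtype.ext (hinj a.2 b.2 (congrArg Subtype.val hab))
  rw [mk_Iio_ordinal, mk_Iio_ordinal, lift_le, card_ord] at hle
  exact absurd (lt_ord.1 hi) (not_lt.2 hle)

/-! ### Coherent ladder systems -/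

/-- A coherent sequence of clubs on the limit ordinals below `K`. -/
structure Ladder (C : Ordinal.{u} → Set Ordinal.{u}) (K : Ordinal.{u}) : Prop where
  subset : ∀ γ < K, C γ ⊆ Set.Iio γ
  unbdd : ∀ γ < K, IsSuccLimit γ → UnbddBelow (C γ) γ
  closed : ∀ γ < K, ∀ τ < γ, UnbddBelow (C γ) τ → τ ∈ C γ
  coherent : ∀ γ < K, ∀ τ < γ, UnbddBelow (C γ) τ → C τ = C γ ∩ Set.Iio τ

/-- A sequence of clubs on the limit ordinals below `K` that is coherent modulo bounded sets. -/
structure TailLadder (c : Ordinal.{u} → Set Ordinal.{u}) (K : Ordinal.{u}) : Prop where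
  subset : ∀ γ < K, c γ ⊆ Set.Iio γ
  unbdd : ∀ γ < K, IsSuccLimit γ → UnbddBelow (c γ) γ
  closed : ∀ γ < K, IsSuccLimit γ → ∀ τ < γ, UnbddBelow (c γ) τ → τ ∈ c γ
  tail : ∀ γ < K, IsSuccLimit γ → ∀ τ < γ, UnbddBelow (c γ) τ →
    ∃ ε < τ, ∀ σ, ε < σ → σ < τ → (σ ∈ c γ ↔ σ ∈ c τ)

/-! ### Order types of bounded sets of ordinals -/

/-- The order type of a bounded set of ordinals, as an ordinal of the same universe. -/
noncomputable def otp (A : Set Ordinal.{u}) : Ordinal.{u} :=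
  sInf {o | Ordinal.type (α := A) (· < ·) ≤ Ordinal.lift.{u + 1} o}

theorem lift_otp {A : Set Ordinal.{u}} {γ : Ordinal.{u}} (hA : A ⊆ Set.Iio γ) :
    Ordinal.lift.{u + 1} (otp A) = Ordinal.type (α := A) (· < ·) := by
  have h1 : Ordinal.type (α := A) (· < ·) ≤ Ordinal.lift.{u + 1} γ := by
    rw [← Ordinal.type_lt_Iio]
    exact Ordinal.type_le_iff'.2 ⟨⟨⟨fun x => ⟨x.1, hA x.2⟩, fun x y h => Subtype.ext (by simpa using h)⟩,
      Iff.rfl⟩⟩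
  obtain ⟨o, ho⟩ := Ordinal.mem_range_lift_of_le h1
  have : otp A = o := by
    refine le_antisymm (csInf_le' ho.ge) (le_csInf ⟨o, ho.ge⟩ fun x hx => ?_)
    rw [Set.mem_ofPred_eq, ← ho, Ordinal.lift_le] at hx
    exact hx
  rw [this, ho]

theorem lift_otp_inter_Iio {A : Set Ordinal.{u}} {x : Ordinal.{u}}
    (hx : x ∈ A) : Ordinal.lift.{u + 1} (otp (A ∩ Set.Iio x)) =
      Ordinal.typein (α := A) (· < ·) ⟨x, hx⟩ := by
  rw [lift_otp (γ := x) Set.inter_subset_right]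
  rw [← Ordinal.type_Iio_lt]
  refine Ordinal.type_eq.2 ⟨⟨⟨fun y => ⟨⟨y.1, y.2.1⟩, y.2.2⟩, fun y => ⟨y.1.1, y.1.2, y.2⟩,
    fun _ => rfl, fun _ => rfl⟩, Iff.rfl⟩⟩

theorem otp_inter_lt {A : Set Ordinal.{u}} {γ x : Ordinal.{u}} (hA : A ⊆ Set.Iio γ)
    (hx : x ∈ A) : otp (A ∩ Set.Iio x) < otp A := by
  rw [← Ordinal.lift_lt.{u + 1, u}, lift_otp hA, lift_otp_inter_Iio hx]
  exact Ordinal.typein_lt_type _ _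

theorem exists_otp_inter_eq {A : Set Ordinal.{u}} {γ o : Ordinal.{u}} (hA : A ⊆ Set.Iio γ)
    (ho : o < otp A) : ∃ x ∈ A, otp (A ∩ Set.Iio x) = o := by
  rw [← Ordinal.lift_lt.{u + 1, u}, lift_otp hA] at ho
  obtain ⟨x, hx⟩ := Ordinal.typein_surj (α := A) (· < ·) ho
  refine ⟨x.1, x.2, ?_⟩
  rw [← Ordinal.lift_inj.{u + 1, u}, lift_otp_inter_Iio x.2, ← hx]

theorem otp_inter_lt_otp_inter {A : Set Ordinal.{u}} {x y : Ordinal.{u}}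
    (hx : x ∈ A) (hxy : x < y) : otp (A ∩ Set.Iio x) < otp (A ∩ Set.Iio y) := by
  have := otp_inter_lt (A := A ∩ Set.Iio y) (γ := y) (x := x) Set.inter_subset_right ⟨hx, hxy⟩
  rwa [Set.inter_assoc, Set.inter_eq_right.2 (Set.Iio_subset_Iio hxy.le)] at this

/-! ### Square sequences -/

/-- In the coherence clause the ordinal ε must be τ itself: a larger ε would put τ into `C τ`, a
smaller one would bound `C τ` below τ. -/
theorem exists_ladder_of_square {l : Cardinal.{u}} (h : Square l) :
    ∃ C : Ordinal.{u} → Set Ordinal.{u}, Ladder C (succ l).ord ∧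
      ∀ γ < (succ l).ord, otp (C γ) ≤ l.ord := by
  obtain ⟨C, hC, hotp, hcoh⟩ := h
  have hclosed : ∀ γ < (succ l).ord, ∀ τ < γ, UnbddBelow (C γ) τ → τ ∈ C γ := by
    intro γ hγ τ hτ hu
    obtain ⟨h1, h2⟩ := sSup_inter_Iio_eq_iff.2 hu
    exact hC.closed γ hγ τ hτ h2 h1
  refine ⟨C, ⟨hC.subset, ?_, hclosed, ?_⟩, ?_⟩
  · intro γ hγ hlim
    have h1 := hC.sSup_eq γ hγ
    have h2 : Set.Iio γ = Set.univ ∩ Set.Iio γ := by simp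
    rw [h2, (sSup_inter_Iio_eq_iff.2 (unbddBelow_of_isSuccLimit hlim)).1,
      ← Set.inter_eq_left.2 (hC.subset γ hγ)] at h1
    exact sSup_inter_Iio_eq_iff.1 ⟨h1, hlim.bot_lt⟩
  · intro γ hγ τ hτ hu
    have hmem := hclosed γ hγ τ hτ hu
    obtain ⟨ε, hε⟩ := hcoh γ hγ τ hτ ⟨hmem, sSup_inter_Iio_eq_iff.2 hu⟩
    have hsub := hC.subset τ (hτ.trans hγ)
    have h1 : ε ≤ τ := by
      by_contra hc
      have : τ ∈ C τ := by rw [hε]; exact ⟨hmem, not_le.1 hc⟩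
      exact lt_irrefl τ (hsub this)
    have h2 : UnbddBelow (C τ) τ := by
      have h1 := hC.sSup_eq τ (hτ.trans hγ)
      have h2 : Set.Iio τ = Set.univ ∩ Set.Iio τ := by simp
      rw [h2, (sSup_inter_Iio_eq_iff.2 (unbddBelow_of_isSuccLimit hu.isSuccLimit)).1,
        ← Set.inter_eq_left.2 hsub] at h1
      exact sSup_inter_Iio_eq_iff.1 ⟨h1, hu.1⟩
    rcases h1.lt_or_eq with h | rfl
    · obtain ⟨y, hy, h3, -⟩ := h2.2 ε h
      rw [hε] at hy
      exact absurd hy.2 (not_lt.2 h3.le)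
    · exact hε
  · intro γ hγ
    rw [← Ordinal.lift_le.{u + 1}, lift_otp (hC.subset γ hγ)]
    exact hotp γ hγ

/-- The square sequence can be thinned out so as to avoid a stationary set of ordinals of countable
cofinality. -/
theorem exists_avoiding_ladder {l : Cardinal.{u}} (hl : ℵ₀ ≤ l)
    {C : Ordinal.{u} → Set Ordinal.{u}} (hC : Ladder C (succ l).ord)
    (hotp : ∀ γ < (succ l).ord, otp (C γ) ≤ l.ord) (hω : ℵ₀ < succ l) :
    ∃ (S : Set Ordinal.{u}) (C' : Ordinal.{u} → Set Ordinal.{u}),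
      (∀ D, ClubIn D (succ l).ord → ∃ δ ∈ S, δ ∈ D ∧ δ < (succ l).ord) ∧
      (∀ δ ∈ S, δ.cof = ℵ₀) ∧ Ladder C' (succ l).ord ∧
      ∀ γ < (succ l).ord, ∀ τ < γ, UnbddBelow (C' γ) τ → τ ∉ S := by
  classical
  have hκ : (succ l).IsRegular := isRegular_succ hl
  -- There are only λ possible order types, so if each class were nonstationary, the intersection of
  -- the witnessing clubs would still contain a point of countable cofinality.
  have hstat : ∃ ρ : Ordinal.{u}, ∀ D, ClubIn D (succ l).ord →
      ∃ δ ∈ {δ | δ.cof = ℵ₀ ∧ otp (C δ) = ρ}, δ ∈ D ∧ δ < (succ l).ord := by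
    by_contra hc
    push Not at hc
    choose D hD1 hD2 using hc
    obtain ⟨τ, h1, h2, h3, -⟩ := (ClubIn.iInter hκ hω (ι := (succ l.ord).ToType)
      (by
        rw [mk_toType, ← lt_ord]
        exact (isSuccLimit_ord_of_isRegular hκ).succ_lt (ord_lt_ord.2 (lt_succ l)))
      (D := fun a => D (toOrd a)) fun a => hD1 _).exists_cof hκ isRegular_aleph0 hω
    have h4 := Set.mem_iInter.1 h1 (ofOrd (otp (C τ)) (lt_succ_of_le (hotp τ h2)))
    rw [toOrd_ofOrd] at h4
    exact absurd h2 (not_lt.2 (hD2 _ τ ⟨h3, rfl⟩ h4))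
  obtain ⟨ρ, hρ⟩ := hstat
  -- A ladder longer than ρ loses its points of index at most ρ. Its accumulation points then have
  -- ladders of type above ρ, those of a ladder of type at most ρ have type below ρ, and type
  -- exactly ρ never occurs.
  let C' : Ordinal.{u} → Set Ordinal.{u} := fun γ =>
    if otp (C γ) ≤ ρ then C γ else {x ∈ C γ | ρ < otp (C γ ∩ Set.Iio x)}
  have hpos : ∀ γ, otp (C γ) ≤ ρ → C' γ = C γ := fun γ h => if_pos h
  have hneg : ∀ γ, ¬ otp (C γ) ≤ ρ → C' γ = {x ∈ C γ | ρ < otp (C γ ∩ Set.Iio x)} :=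
    fun γ h => if_neg h
  have hsub : ∀ γ, C' γ ⊆ C γ := by
    intro γ
    by_cases h : otp (C γ) ≤ ρ
    · rw [hpos γ h]
    · rw [hneg γ h]; exact fun x hx => hx.1
  have main : ∀ γ < (succ l).ord, ∀ τ < γ, UnbddBelow (C' γ) τ →
      τ ∈ C' γ ∧ C' τ = C' γ ∩ Set.Iio τ ∧ otp (C τ) ≠ ρ := by
    intro γ hγ τ hτ hu
    have hu' : UnbddBelow (C γ) τ := hu.mono fun x hx _ => hsub γ hx
    have hmem := hC.closed γ hγ τ hτ hu'
    have hco := hC.coherent γ hγ τ hτ hu'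
    by_cases h : otp (C γ) ≤ ρ
    · have h1 : otp (C τ) < ρ := by
        rw [hco]; exact (otp_inter_lt (hC.subset γ hγ) hmem).trans_le h
      rw [hpos γ h, hpos τ h1.le]
      exact ⟨hmem, hco, h1.ne⟩
    · obtain ⟨x, hx, -, hxτ⟩ := hu.2 0 hu.1
      rw [hneg γ h] at hx
      have h1 : ρ < otp (C τ) := by
        rw [hco]; exact hx.2.trans (otp_inter_lt_otp_inter hx.1 hxτ)
      have h2 : ρ < otp (C γ ∩ Set.Iio τ) := by rwa [← hco]
      rw [hneg γ h, hneg τ (not_le.2 h1)]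
      refine ⟨⟨hmem, h2⟩, ?_, h1.ne'⟩
      ext y
      simp only [Set.mem_ofPred_eq, Set.mem_inter_iff, Set.mem_Iio, hco]
      constructor
      · rintro ⟨⟨h3, h4⟩, h5⟩
        rw [Set.inter_assoc, Set.inter_eq_right.2 (Set.Iio_subset_Iio h4.le)] at h5
        exact ⟨⟨h3, h5⟩, h4⟩
      · rintro ⟨⟨h3, h5⟩, h4⟩
        rw [Set.inter_assoc, Set.inter_eq_right.2 (Set.Iio_subset_Iio h4.le)]
        exact ⟨⟨h3, h4⟩, h5⟩
  refine ⟨_, C', hρ, fun δ hδ => hδ.1, ⟨fun γ hγ => (hsub γ).trans (hC.subset γ hγ), ?_,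
    fun γ hγ τ hτ hu => (main γ hγ τ hτ hu).1, fun γ hγ τ hτ hu => (main γ hγ τ hτ hu).2.1⟩,
    fun γ hγ τ hτ hu hS => (main γ hγ τ hτ hu).2.2 hS.2⟩
  intro γ hγ hlim
  have hu := hC.unbdd γ hγ hlim
  by_cases h : otp (C γ) ≤ ρ
  · rwa [hpos γ h]
  · obtain ⟨x, hx, hxρ⟩ := exists_otp_inter_eq (hC.subset γ hγ) (not_le.1 h)
    rw [hneg γ h]
    refine (hu.above (hC.subset γ hγ hx)).mono fun y hy _ => ⟨hy.1, ?_⟩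
    rw [← hxρ]
    exact otp_inter_lt_otp_inter hx hy.2

/-! ### Ladders with successor points in a prescribed set -/

/-- The supremum of the part of `E` up to `ζ`. -/
noncomputable def supUpTo (E : Set Ordinal.{u}) (ζ : Ordinal.{u}) : Ordinal.{u} :=
  sSup (E ∩ Set.Iic ζ)

section supUpTo
variable {E : Set Ordinal.{u}} {ζ ξ δ : Ordinal.{u}}

theorem bddAbove_inter_Iic (E : Set Ordinal.{u}) (ζ : Ordinal.{u}) : BddAbove (E ∩ Set.Iic ζ) :=
  ⟨ζ, fun _ hx => hx.2⟩

theorem supUpTo_le : supUpTo E ζ ≤ ζ := csSup_le' fun _ hx => hx.2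

theorem le_supUpTo (hδ : δ ∈ E) (h : δ ≤ ζ) : δ ≤ supUpTo E ζ :=
  le_csSup (bddAbove_inter_Iic E ζ) ⟨hδ, h⟩

theorem supUpTo_mono (h : ξ ≤ ζ) : supUpTo E ξ ≤ supUpTo E ζ :=
  csSup_le_csSup' (bddAbove_inter_Iic E ζ) fun _ hx => ⟨hx.1, hx.2.trans h⟩

theorem supUpTo_anti {E' : Set Ordinal.{u}} (h : E' ⊆ E) : supUpTo E' ζ ≤ supUpTo E ζ :=
  csSup_le_csSup' (bddAbove_inter_Iic E ζ) fun _ hx => ⟨h hx.1, hx.2⟩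

theorem supUpTo_eq_self (h : UnbddBelow E ζ) : supUpTo E ζ = ζ := by
  refine le_antisymm supUpTo_le ?_
  by_contra hc
  obtain ⟨y, hy, h1, h2⟩ := h.2 _ (not_le.1 hc)
  exact absurd (le_supUpTo hy h2.le) (not_le.2 h1)

theorem unbddBelow_supUpTo (hne : (E ∩ Set.Iic ζ).Nonempty) (h : supUpTo E ζ ∉ E) :
    UnbddBelow E (supUpTo E ζ) := by
  have hlt : ∀ y ∈ E, y ≤ ζ → y < supUpTo E ζ := fun y hy hyζ =>
    (le_supUpTo hy hyζ).lt_of_ne fun heq => h (heq ▸ hy)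
  obtain ⟨y, hy, hyζ⟩ := hne
  refine ⟨(zero_le).trans_lt (hlt y hy hyζ), fun x hx => ?_⟩
  obtain ⟨z, hz, hxz⟩ := exists_lt_of_lt_csSup
    (show (E ∩ Set.Iic ζ).Nonempty from ⟨y, hy, hyζ⟩) hx
  exact ⟨z, hz.1, hxz, hlt z hz.1 hz.2⟩

end supUpTo

section Swallow

variable (C : Ordinal.{u} → Set Ordinal.{u}) (E : Set Ordinal.{u})

open Classical in
/-- The projection of the ladder at `γ` to the closure of `E`. -/
noncomputable def projLadder (γ : Ordinal.{u}) : Set Ordinal.{u} :=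
  if UnbddBelow E γ then {x | ∃ ζ ∈ C γ, (E ∩ Set.Iic ζ).Nonempty ∧ x = supUpTo E ζ}
  else {x ∈ C γ | ∀ y ∈ E, y < γ → y < x}

/-- `Swallow C E γ` is the ladder at `γ` obtained from the projected ladder by filling the gap below
each successor point outside of `E` with the ladder of that point. -/
inductive Swallow : Ordinal.{u} → Ordinal.{u} → Prop
  | base {γ τ : Ordinal.{u}} : τ ∈ projLadder C E γ → Swallow γ τ
  | step {γ β τ : Ordinal.{u}} : β ∈ projLadder C E γ → β ∉ E → UnbddBelow E β → τ < β →
      (∀ x ∈ projLadder C E γ, x < β → x < τ) → Swallow β τ → Swallow γ τ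

variable {C E} {K : Ordinal.{u}}

theorem mem_projLadder_of_unbdd {γ x : Ordinal.{u}} (h : UnbddBelow E γ) :
    x ∈ projLadder C E γ ↔ ∃ ζ ∈ C γ, (E ∩ Set.Iic ζ).Nonempty ∧ x = supUpTo E ζ := by
  rw [projLadder, if_pos h]; rfl

theorem mem_projLadder_of_not_unbdd {γ x : Ordinal.{u}} (h : ¬ UnbddBelow E γ) :
    x ∈ projLadder C E γ ↔ x ∈ C γ ∧ ∀ y ∈ E, y < γ → y < x := by
  rw [projLadder, if_neg h]; rfl

theorem projLadder_subset (hC : Ladder C K) {γ : Ordinal.{u}} (hγ : γ < K) :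
    projLadder C E γ ⊆ Set.Iio γ := by
  intro x hx
  by_cases h : UnbddBelow E γ
  · obtain ⟨ζ, hζ, -, rfl⟩ := (mem_projLadder_of_unbdd h).1 hx
    exact supUpTo_le.trans_lt (hC.subset γ hγ hζ)
  · exact hC.subset γ hγ ((mem_projLadder_of_not_unbdd h).1 hx).1

theorem projLadder_unbdd (hC : Ladder C K) {γ : Ordinal.{u}} (hγ : γ < K) (hlim : IsSuccLimit γ) :
    UnbddBelow (projLadder C E γ) γ := by
  have hu := hC.unbdd γ hγ hlim
  refine ⟨hlim.bot_lt, fun x hx => ?_⟩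
  by_cases h : UnbddBelow E γ
  · obtain ⟨y, hy, h1, h2⟩ := h.2 x hx
    obtain ⟨ζ, hζ, h3, h4⟩ := hu.2 y h2
    exact ⟨supUpTo E ζ, (mem_projLadder_of_unbdd h).2 ⟨ζ, hζ, ⟨y, hy, h3.le⟩, rfl⟩,
      h1.trans_le (le_supUpTo hy h3.le), supUpTo_le.trans_lt h4⟩
  · obtain ⟨x0, h0, h1⟩ := not_unbddBelow h hlim.bot_lt
    obtain ⟨ζ, hζ, h3, h4⟩ := hu.2 (max x x0) (max_lt hx h0)
    refine ⟨ζ, (mem_projLadder_of_not_unbdd h).2 ⟨hζ, fun y hy hyγ => ?_⟩,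
      (le_max_left _ _).trans_lt h3, h4⟩
    by_contra hc
    exact absurd (h1 y hy (((le_max_right _ _).trans_lt h3).trans_le (not_lt.1 hc)))
      (not_le.2 hyγ)

/-- When `E` is unbounded below γ, a limit τ of projected points is also a limit of `E`, hence fixed
by the projection, so projecting the part of `C γ` below τ gives exactly the projected points below
τ. Otherwise the projected ladder is a tail of `C γ`. -/
theorem projLadder_coherent (hC : Ladder C K) {γ τ : Ordinal.{u}} (hγ : γ < K) (hτ : τ < γ)
    (hu : UnbddBelow (projLadder C E γ) τ) :
    τ ∈ projLadder C E γ ∧ projLadder C E τ = projLadder C E γ ∩ Set.Iio τ := by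
  by_cases h : UnbddBelow E γ
  · have hEτ : UnbddBelow E τ := by
      refine ⟨hu.1, fun x hx => ?_⟩
      obtain ⟨y, hy, h1, h2⟩ := hu.2 x hx
      obtain ⟨ζ, hζ, hne, rfl⟩ := (mem_projLadder_of_unbdd h).1 hy
      obtain ⟨z, hz, hxz⟩ := exists_lt_of_lt_csSup hne h1
      exact ⟨z, hz.1, hxz, (le_supUpTo hz.1 hz.2).trans_lt h2⟩
    have hlt : ∀ ζ, supUpTo E ζ < τ → ζ < τ := by
      intro ζ h1
      by_contra hc
      exact absurd ((supUpTo_eq_self hEτ).symm.le.trans (supUpTo_mono (not_lt.1 hc))) (not_le.2 h1)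
    have hCτ : UnbddBelow (C γ) τ := by
      refine ⟨hu.1, fun x hx => ?_⟩
      obtain ⟨y, hy, h1, h2⟩ := hu.2 x hx
      obtain ⟨ζ, hζ, hne, rfl⟩ := (mem_projLadder_of_unbdd h).1 hy
      exact ⟨ζ, hζ, h1.trans_le supUpTo_le, hlt ζ h2⟩
    have hco := hC.coherent γ hγ τ hτ hCτ
    constructor
    · obtain ⟨y, hy, -, h2⟩ := hEτ.2 0 hEτ.1
      exact (mem_projLadder_of_unbdd h).2 ⟨τ, hC.closed γ hγ τ hτ hCτ, ⟨y, hy, h2.le⟩,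
        (supUpTo_eq_self hEτ).symm⟩
    · ext x
      rw [mem_projLadder_of_unbdd hEτ, Set.mem_inter_iff, mem_projLadder_of_unbdd h, hco]
      constructor
      · rintro ⟨ζ, ⟨hζ, h1⟩, hne, rfl⟩
        exact ⟨⟨ζ, hζ, hne, rfl⟩, supUpTo_le.trans_lt h1⟩
      · rintro ⟨⟨ζ, hζ, hne, rfl⟩, h1⟩
        exact ⟨ζ, ⟨hζ, hlt ζ h1⟩, hne, rfl⟩
  · have hCτ : UnbddBelow (C γ) τ :=
      hu.mono fun x hx _ => ((mem_projLadder_of_not_unbdd h).1 hx).1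
    have hco := hC.coherent γ hγ τ hτ hCτ
    have hEτ : ∀ y ∈ E, y < γ → y < τ := by
      intro y hy hyγ
      obtain ⟨x, hx, -, h2⟩ := hu.2 0 hu.1
      exact (((mem_projLadder_of_not_unbdd h).1 hx).2 y hy hyγ).trans h2
    have hnot : ¬ UnbddBelow E τ := by
      intro hc
      obtain ⟨x, hx, -, h2⟩ := hu.2 0 hu.1
      obtain ⟨y, hy, h3, h4⟩ := hc.2 x h2
      exact absurd (((mem_projLadder_of_not_unbdd h).1 hx).2 y hy (h4.trans hτ)) (not_lt.2 h3.le)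
    refine ⟨(mem_projLadder_of_not_unbdd h).2 ⟨hC.closed γ hγ τ hτ hCτ, hEτ⟩, ?_⟩
    ext x
    rw [mem_projLadder_of_not_unbdd hnot, Set.mem_inter_iff, mem_projLadder_of_not_unbdd h, hco]
    constructor
    · rintro ⟨⟨h1, h2⟩, h3⟩
      exact ⟨⟨h1, fun y hy hyγ => h3 y hy (hEτ y hy hyγ)⟩, h2⟩
    · rintro ⟨⟨h1, h3⟩, h2⟩
      exact ⟨⟨h1, h2⟩, fun y hy hyτ => h3 y hy (hyτ.trans hτ)⟩

/-- The least point of a set of ordinals that is at least `τ`. -/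
theorem exists_least_ge {A : Set Ordinal.{u}} {τ y : Ordinal.{u}} (hy : y ∈ A) (h : τ ≤ y) :
    ∃ β ∈ A, τ ≤ β ∧ β ≤ y ∧ ∀ x ∈ A, x < β → x < τ := by
  have hne : (A ∩ Set.Ici τ).Nonempty := ⟨y, hy, h⟩
  have hmem := csInf_mem hne
  refine ⟨sInf (A ∩ Set.Ici τ), hmem.1, hmem.2, csInf_le' ⟨hy, h⟩, fun x hx hlt => ?_⟩
  by_contra hc
  exact absurd (csInf_le' (s := A ∩ Set.Ici τ) ⟨hx, not_lt.1 hc⟩) (not_le.2 hlt)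

/-- A point in the gap just below β cannot be a projected point, and can have been added only by
filling that gap. -/
theorem swallow_iff {γ β σ : Ordinal.{u}} (hβ : β ∈ projLadder C E γ) (hσ : σ < β)
    (h : ∀ x ∈ projLadder C E γ, x < β → x < σ) :
    Swallow C E γ σ ↔ β ∉ E ∧ UnbddBelow E β ∧ Swallow C E β σ := by
  constructor
  · intro hs
    cases hs with
    | base h1 => exact absurd (h σ h1 hσ) (lt_irrefl _)
    | @step _ β' _ h1 h2 h3 h4 h5 h6 =>
      have : β' = β := by
        rcases lt_trichotomy β' β with h7 | h7 | h7
        · exact absurd (h β' h1 h7) (not_lt.2 h4.le)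
        · exact h7
        · exact absurd (h5 β hβ h7) (not_lt.2 hσ.le)
      subst this
      exact ⟨h2, h3, h6⟩
  · rintro ⟨h1, h2, h3⟩
    exact .step hβ h1 h2 hσ h h3

theorem Swallow.lt (hC : Ladder C K) {γ σ : Ordinal.{u}} (hs : Swallow C E γ σ) :
    γ < K → σ < γ := by
  induction hs with
  | base h => exact fun hγ => projLadder_subset hC hγ h
  | step h1 h2 h3 h4 h5 h6 ih =>
    exact fun hγ => h4.trans (projLadder_subset hC hγ h1)

/-- If the projected ladder agrees with its restriction, so does the swallowing ladder. -/
theorem swallow_congr (hC : Ladder C K) {γ τ : Ordinal.{u}} (hγ : γ < K) (hτ : τ < γ)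
    (hu : UnbddBelow (projLadder C E γ) τ) {σ : Ordinal.{u}} (hσ : σ < τ) :
    Swallow C E γ σ ↔ Swallow C E τ σ := by
  have hco := (projLadder_coherent hC hγ hτ hu).2
  obtain ⟨y, hy, h1, h2⟩ := hu.2 σ hσ
  obtain ⟨β, hβ, h3, h4, h5⟩ := exists_least_ge hy h1.le
  have hβτ : β < τ := h4.trans_lt h2
  have hβ' : β ∈ projLadder C E τ := by rw [hco]; exact ⟨hβ, hβτ⟩
  rcases h3.lt_or_eq with h | rfl
  · rw [swallow_iff hβ h h5, swallow_iff hβ' h]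
    intro x hx hxβ
    rw [hco] at hx
    exact h5 x hx.1 hxβ
  · exact ⟨fun _ => .base hβ', fun _ => .base hβ⟩

/-- A limit τ of projected points inherits full coherence from the projected ladder. Any other limit
lies in, or at the top of, one gap, where the ladder is a tail of the one at the gap's top β < γ;
induction applies to β. The passage to a gap is why coherence survives only modulo a bounded set. -/
theorem swallow_closed_tail (hC : Ladder C K) (γ : Ordinal.{u}) :
    γ < K → IsSuccLimit γ → ∀ τ < γ, UnbddBelow {σ | Swallow C E γ σ} τ →
      Swallow C E γ τ ∧
      ∃ ε < τ, ∀ σ, ε < σ → σ < τ → (Swallow C E γ σ ↔ Swallow C E τ σ) := by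
  induction γ using WellFoundedLT.induction with
  | ind γ ih =>
    intro hγ hlim τ hτ hu
    by_cases hpu : UnbddBelow (projLadder C E γ) τ
    · exact ⟨.base (projLadder_coherent hC hγ hτ hpu).1, 0, hu.1,
        fun σ _ hσ => swallow_congr hC hγ hτ hpu hσ⟩
    obtain ⟨x0, hx0, hx⟩ := not_unbddBelow hpu hu.1
    obtain ⟨y, hy, h1, h2⟩ := (projLadder_unbdd hC hγ hlim).2 τ hτ
    obtain ⟨β, hβ, h3, h4, h5⟩ := exists_least_ge (A := projLadder C E γ) hy h1.le
    have hmin : ∀ σ, x0 < σ → σ < τ → ∀ x ∈ projLadder C E γ, x < β → x < σ := by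
      intro σ hσ hστ x hx' hxβ
      by_contra hc
      exact absurd (hx x hx' (hσ.trans_le (not_lt.1 hc))) (not_le.2 (h5 x hx' hxβ))
    have hiff : ∀ σ, x0 < σ → σ < τ → (Swallow C E γ σ ↔ β ∉ E ∧ UnbddBelow E β ∧
        Swallow C E β σ) := fun σ hσ hστ =>
      swallow_iff hβ (hστ.trans_le h3) (hmin σ hσ hστ)
    obtain ⟨σ0, hσ0, hσ1, hσ2⟩ := hu.2 x0 hx0
    obtain ⟨hβE, hβu, -⟩ := (hiff σ0 hσ1 hσ2).1 hσ0
    rcases h3.lt_or_eq with h | rfl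
    · have hu' : UnbddBelow {σ | Swallow C E β σ} τ :=
        (hu.above hx0).mono fun σ hσ hστ => ((hiff σ hσ.2 hστ).1 hσ.1).2.2
      have hβγ : β < γ := projLadder_subset hC hγ hβ
      obtain ⟨h6, ε, hε, h7⟩ := ih β hβγ (hβγ.trans hγ) hβu.isSuccLimit τ h hu'
      refine ⟨.step hβ hβE hβu h h5 h6, max ε x0, max_lt hε hx0, fun σ hσ hστ => ?_⟩
      rw [hiff σ ((le_max_right _ _).trans_lt hσ) hστ, ← h7 σ ((le_max_left _ _).trans_lt hσ) hστ]
      exact ⟨fun h => h.2.2, fun h => ⟨hβE, hβu, h⟩⟩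
    · refine ⟨.base hβ, x0, hx0, fun σ hσ hστ => ?_⟩
      rw [hiff σ hσ hστ]
      exact ⟨fun h => h.2.2, fun h => ⟨hβE, hβu, h⟩⟩

theorem tailLadder_swallow (hC : Ladder C K) (E : Set Ordinal.{u}) :
    TailLadder (fun γ => {σ | Swallow C E γ σ}) K where
  subset _ hγ _ hσ := Swallow.lt hC hσ hγ
  unbdd _ hγ hlim := (projLadder_unbdd hC hγ hlim).mono fun _ hx _ => .base hx
  closed γ hγ hlim τ hτ hu := (swallow_closed_tail hC γ hγ hlim τ hτ hu).1
  tail γ hγ hlim τ hτ hu := (swallow_closed_tail hC γ hγ hlim τ hτ hu).2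

end Swallow

/-! ### Guessing at successor points of ladders -/

/-- `β` is a point of `A` which is not a limit of points of `A`. -/
def IsNacc (A : Set Ordinal.{u}) (β : Ordinal.{u}) : Prop :=
  β ∈ A ∧ ∃ x < β, ∀ σ ∈ A, x < σ → β ≤ σ

theorem exists_forall_ge_eq {f : ℕ → Ordinal.{u}} (hf : Antitone f) : ∃ n, ∀ m ≥ n, f m = f n := by
  have hmem := csInf_mem (Set.range_nonempty f)
  obtain ⟨n, hn⟩ := hmem
  exact ⟨n, fun m hm => le_antisymm (hf hm) (hn ▸ csInf_le' ⟨m, rfl⟩)⟩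

/-- Descend from γ towards δ as in a walk on ordinals: project the first point ζ of `C γ` at or
above δ. The projections decrease with n, so stabilise at some β. Either β lies in every `E m`, and
is then a successor point because gaps below points of `E m` are not filled; or it eventually lies
outside, the gap is filled by the ladder at β, and the descent continues from β. -/
theorem exists_stable_nacc {C : Ordinal.{u} → Set Ordinal.{u}} {K : Ordinal.{u}} (hC : Ladder C K)
    {E : ℕ → Set Ordinal.{u}} (hE : Antitone E)
    (havoid : ∀ γ < K, ∀ τ < γ, UnbddBelow (C γ) τ → τ ∉ E 0)
    {δ : Ordinal.{u}} (hδ0 : 0 < δ) (hδ : ∀ n, δ ∈ E n) (γ : Ordinal.{u}) :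
    γ < K → δ < γ → (∃ n, ∀ m ≥ n, UnbddBelow (E m) γ) →
      ∃ β, δ ≤ β ∧ β < γ ∧ (∀ m, β ∈ E m) ∧
        ∃ n, ∀ m ≥ n, IsNacc {σ | Swallow C (E m) γ σ} β := by
  induction γ using WellFoundedLT.induction with
  | ind γ ih =>
    rintro hγ hδγ ⟨n1, hn1⟩
    have hlim := (hn1 n1 le_rfl).isSuccLimit
    -- As δ lies in the avoided set, it is not an accumulation point of `C γ`; this gap makes β the
    -- first projected point above `x1`.
    have hx1 : ∃ x1 < δ, ∀ y ∈ C γ, x1 < y → δ ≤ y :=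
      not_unbddBelow (fun h => havoid γ hγ δ hδγ h (hδ 0)) hδ0
    obtain ⟨x1, hx1, hx1'⟩ := hx1
    obtain ⟨y, hy, h1, h2⟩ := (hC.unbdd γ hγ hlim).2 δ hδγ
    obtain ⟨ζ, hζ, h3, h4, h5⟩ := exists_least_ge hy h1.le
    have hanti : Antitone fun n => supUpTo (E n) ζ := fun a b hab => supUpTo_anti (hE hab)
    obtain ⟨n2, hn2⟩ := exists_forall_ge_eq hanti
    obtain ⟨β, hβ⟩ : ∃ β, β = supUpTo (E n2) ζ := ⟨_, rfl⟩
    have hβn : ∀ m ≥ n2, supUpTo (E m) ζ = β := fun m hm => by rw [hβ]; exact hn2 m hm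
    have hδβ : δ ≤ β := hβ ▸ le_supUpTo (hδ n2) h3
    have hβγ : β < γ := (hβ ▸ supUpTo_le : β ≤ ζ).trans_lt (hC.subset γ hγ hζ)
    have hproj : ∀ m ≥ max n1 n2, β ∈ projLadder C (E m) γ := fun m hm =>
      (mem_projLadder_of_unbdd (hn1 m ((le_max_left _ _).trans hm))).2
        ⟨ζ, hζ, ⟨δ, hδ m, h3⟩, (hβn m ((le_max_right _ _).trans hm)).symm⟩
    have hlow : ∀ m ≥ max n1 n2, ∀ x ∈ projLadder C (E m) γ, x < β → x ≤ x1 := by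
      intro m hm x hx hxβ
      obtain ⟨ζ', hζ', -, rfl⟩ := (mem_projLadder_of_unbdd (hn1 m ((le_max_left _ _).trans hm))).1 hx
      have h6 : ζ' < ζ := by
        by_contra hc
        have := supUpTo_mono (E := E m) (not_lt.1 hc)
        rw [hβn m ((le_max_right _ _).trans hm)] at this
        exact absurd hxβ (not_lt.2 this)
      have h7 : ζ' ≤ x1 := by
        by_contra hc
        exact absurd (hx1' ζ' hζ' (not_le.1 hc)) (not_le.2 (h5 ζ' hζ' h6))
      exact supUpTo_le.trans h7
    by_cases hall : ∀ m, β ∈ E m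
    · refine ⟨β, hδβ, hβγ, hall, max n1 n2, fun m hm => ⟨.base (hproj m hm), x1,
        hx1.trans_le hδβ, fun σ hσ hxσ => ?_⟩⟩
      by_contra hc
      exact ((swallow_iff (hproj m hm) (not_le.1 hc) fun x hx hxβ =>
        (hlow m hm x hx hxβ).trans_lt hxσ).1 hσ).1 (hall m)
    · push Not at hall
      obtain ⟨n3, hn3⟩ := hall
      have hnot : ∀ m ≥ n3, β ∉ E m := fun m hm h => hn3 (hE hm h)
      have hub : ∀ m ≥ max n2 n3, UnbddBelow (E m) β := by
        intro m hm
        have h6 := hβn m ((le_max_left _ _).trans hm)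
        have := unbddBelow_supUpTo (E := E m) (ζ := ζ) ⟨δ, hδ m, h3⟩
          (by rw [h6]; exact hnot m ((le_max_right _ _).trans hm))
        rwa [h6] at this
      have hδβ' : δ < β := hδβ.lt_of_ne fun h => hn3 (h ▸ hδ n3)
      obtain ⟨β', h6, h7, h8, n4, h9⟩ := ih β hβγ (hβγ.trans hγ) hδβ' ⟨_, hub⟩
      refine ⟨β', h6, h7.trans hβγ, h8, max (max n1 n2) (max n3 n4), fun m hm => ?_⟩
      have hm1 : m ≥ max n1 n2 := (le_max_left _ _).trans hm
      have hm3 : m ≥ n3 := ((le_max_left _ _).trans (le_max_right _ _)).trans hm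
      have hm4 : m ≥ n4 := ((le_max_right _ _).trans (le_max_right _ _)).trans hm
      have hm5 : m ≥ max n2 n3 := max_le ((le_max_right _ _).trans hm1) hm3
      have hiff : ∀ σ, x1 < σ → σ < β → (Swallow C (E m) γ σ ↔ Swallow C (E m) β σ) := by
        intro σ hσ hσβ
        rw [swallow_iff (hproj m hm1) hσβ fun x hx hxβ => (hlow m hm1 x hx hxβ).trans_lt hσ]
        exact ⟨fun h => h.2.2, fun h => ⟨hnot m hm3, hub m hm5, h⟩⟩
      obtain ⟨h10, x2, h11, h12⟩ := h9 m hm4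
      refine ⟨(hiff β' (hx1.trans_le h6) h7).2 h10, max x1 x2,
        max_lt (hx1.trans_le h6) h11, fun σ hσ hxσ => ?_⟩
      by_contra hc
      have h13 := not_le.1 hc
      exact absurd (h12 σ ((hiff σ ((le_max_left _ _).trans_lt hxσ) (h13.trans h7)).1 hσ)
        ((le_max_right _ _).trans_lt hxσ)) (not_le.2 h13)

theorem clubIn_Ioi {κ : Cardinal.{u}} (hκ : κ.IsRegular) {x : Ordinal.{u}} (hx : x < κ.ord) :
    ClubIn (Set.Ioi x) κ.ord := by
  have hlim := isSuccLimit_ord_of_isRegular hκ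
  refine ⟨⟨hκ.ord_pos, fun y hy => ⟨succ (max x y), ?_, ?_, hlim.succ_lt (max_lt hx hy)⟩⟩,
    fun τ _ h => ?_⟩
  · exact Set.mem_Ioi.2 (lt_succ_of_le (le_max_left x y))
  · exact lt_succ_of_le (le_max_right x y)
  · obtain ⟨y, hy, -, h2⟩ := h.2 0 h.1
    exact lt_trans hy h2

/-- A tail-coherent ladder system on `l⁺` that guesses functions at the successor points of a ladder
at a point of cofinality `l`. -/
theorem exists_guessing_tailLadder {l : Cardinal.{u}} (hl : l.IsRegular) (hl0 : ℵ₀ < l)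
    (hpow : (2 : Cardinal.{u}) ^ l = succ l)
    {C : Ordinal.{u} → Set Ordinal.{u}} (hC : Ladder C (succ l).ord)
    (hotp : ∀ γ < (succ l).ord, otp (C γ) ≤ l.ord)
    {Y : Type u} [Nonempty Y] (hY : #Y ≤ 2 ^ l) :
    ∃ (c : Ordinal.{u} → Set Ordinal.{u}) (Ω : Ordinal.{u} → Ordinal.{u} → Y),
      TailLadder c (succ l).ord ∧ ∀ (f : Ordinal.{u} → Y) (D : Set Ordinal.{u}),
        ClubIn D (succ l).ord → ∃ γ < (succ l).ord, γ.cof = l ∧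
          UnbddBelow {β | β ∈ D ∧ IsNacc (c γ) β ∧ ∀ x < β, Ω β x = f x} γ := by
  have hκ : (succ l).IsRegular := isRegular_succ hl.aleph0_le
  have hκ0 : ℵ₀ < succ l := hl0.trans (lt_succ l)
  obtain ⟨S, C', hS, hScof, hC', havoid⟩ := exists_avoiding_ladder hl.aleph0_le hC hotp hκ0
  -- Guessing ω-sequences makes countably many guesses at once: coordinate n serves stage n of the
  -- construction below.
  obtain ⟨d, hd⟩ := exists_diamond hl.aleph0_le hpow hS
    (fun δ hδ => by rw [hScof δ hδ, hl.cof_ord]; exact hl0.ne) (Y := ℕ → Y) (by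
      have h1 : #(ℕ → Y) = #Y ^ (ℵ₀ : Cardinal.{u}) := by simp
      rw [h1]
      calc _ ≤ ((2 : Cardinal.{u}) ^ l) ^ ℵ₀ := power_le_power_right hY
        _ = 2 ^ l := by rw [← power_mul, mul_aleph0_eq hl0.le])
  by_contra hfail
  have hfail' : ∀ (E : Set Ordinal.{u}) (n : ℕ), ∃ (f : Ordinal.{u} → Y) (D : Set Ordinal.{u}),
      ClubIn D (succ l).ord ∧ ∀ γ < (succ l).ord, γ.cof = l →
        ¬ UnbddBelow {β | β ∈ D ∧ IsNacc {σ | Swallow C' E γ σ} β ∧ ∀ x < β, d β x n = f x} γ := by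
    intro E n
    by_contra hc
    push Not at hc
    exact hfail ⟨fun γ => {σ | Swallow C' E γ σ}, fun β x => d β x n, tailLadder_swallow hC' E, hc⟩
  choose badf badD hbadD hbad using hfail'
  -- Each stage retains the points of the current set that are in the bad club and where coordinate
  -- n guesses the bad function correctly.
  let E : ℕ → Set Ordinal.{u} := fun n => Nat.rec S
    (fun n E => {β ∈ E | β ∈ badD E n ∧ ∀ x < β, d β x n = badf E n x}) n
  have hEsucc : ∀ n, E (n + 1) = {β ∈ E n | β ∈ badD (E n) n ∧
    ∀ x < β, d β x n = badf (E n) n x} := fun n => rfl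
  have hE : Antitone E := antitone_nat_of_succ_le fun n => by
    rw [hEsucc]; exact fun x hx => hx.1
  have hunb : UnbddBelow (⋂ n, E n) (succ l).ord := by
    refine ⟨hκ.ord_pos, fun x hx => ?_⟩
    -- Guessing all the bad functions simultaneously puts δ into every `E n`.
    obtain ⟨δ, h1, ⟨h2, h3⟩, h4, h5⟩ := hd (fun x n => badf (E n) n x) _
      ((ClubIn.iInter_nat hκ hκ0 fun n => hbadD (E n) n).inter hκ hκ0 (clubIn_Ioi hκ hx))
    refine ⟨δ, Set.mem_iInter.2 fun n => ?_, h3, h4⟩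
    induction n with
    | zero => exact h1
    | succ n ih =>
      rw [hEsucc]
      exact ⟨ih, Set.mem_iInter.1 h2 n, fun x hx => congrFun (h5 x hx) n⟩
  obtain ⟨γ, h1, h2, h3, -⟩ := (hunb.clubIn hκ hκ0).exists_cof hκ hl (lt_succ l)
  have hγ0 : 0 < γ := h1.1
  choose x hx hx' using fun n => not_unbddBelow (hbad (E n) n γ h2 h3) hγ0
  -- Uncountable cofinality of γ bounds all the stagewise failures by one `b`; a stable successor
  -- point above `b` then refutes the failure at its stage.
  obtain ⟨b, hb, hbx⟩ := exists_bound_nat x (by rw [h3]; exact hl0) hx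
  obtain ⟨δ, hδ, hbδ, hδγ⟩ := h1.2 b hb
  obtain ⟨β, hβ1, hβ2, hβ3, n, hn⟩ := exists_stable_nacc hC' hE havoid
    ((zero_le).trans_lt hbδ) (Set.mem_iInter.1 hδ) γ h2 hδγ
    ⟨0, fun m _ => h1.mono fun y hy _ => Set.mem_iInter.1 hy m⟩
  have hβn := hβ3 (n + 1)
  rw [hEsucc] at hβn
  exact absurd (hx' n β ⟨hβn.2.1, hn n le_rfl, hβn.2.2⟩
    ((hbx n).trans_lt (hbδ.trans_le hβ1))) (not_le.2 hβ2)

/-! ### A diamond along the ladders -/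

theorem card_otp_ge_cof {A : Set Ordinal.{u}} {γ : Ordinal.{u}} (hA : A ⊆ Set.Iio γ)
    (hu : UnbddBelow A γ) : γ.cof ≤ (otp A).card := by
  by_contra hc
  choose! x hx1 hx2 using fun o (ho : o < otp A) => exists_otp_inter_eq hA ho
  obtain ⟨b, hb, h⟩ := exists_bound_Iio x (not_le.1 hc) fun i hi => hA (hx1 i hi)
  obtain ⟨y, hy, hby, -⟩ := hu.2 b hb
  have h1 := otp_inter_lt hA hy
  have h2 : x (otp (A ∩ Set.Iio y)) = y := by
    rcases lt_trichotomy (x (otp (A ∩ Set.Iio y))) y with h3 | h3 | h3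
    · exact absurd (hx2 _ h1) (otp_inter_lt_otp_inter (hx1 _ h1) h3).ne
    · exact h3
    · exact absurd (hx2 _ h1) (otp_inter_lt_otp_inter hy h3).ne'
  exact absurd (h _ h1) (not_le.2 (h2.symm ▸ hby))

/-- At cofinality μ⁺ the ladder has type exactly μ⁺, so a diamond sequence on μ⁺ is transported
along its enumeration `x`. By coherence the order type of `C δ`, and those of its initial segments,
recover indices without knowing γ, so a single sequence serves all γ. -/
theorem exists_local_diamond {μ : Cardinal.{u}} (hμ : ℵ₀ < μ)
    (hpow : (2 : Cardinal.{u}) ^ μ = succ μ)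
    {C : Ordinal.{u} → Set Ordinal.{u}} (hC : Ladder C (succ (succ μ)).ord)
    (hotp : ∀ γ < (succ (succ μ)).ord, otp (C γ) ≤ (succ μ).ord)
    {Y : Type u} [Nonempty Y] (hY : #Y ≤ 2 ^ μ) :
    ∃ d : Ordinal.{u} → Ordinal.{u} → Y, ∀ γ < (succ (succ μ)).ord, γ.cof = succ μ →
      ∀ (f : Ordinal.{u} → Y) (V : Set Ordinal.{u}), UnbddBelow V γ →
        ∃ δ < γ, UnbddBelow V δ ∧ UnbddBelow (C γ) δ ∧ δ.cof ≠ succ μ ∧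
          ∀ β ∈ C γ, β < δ → d δ β = f β := by
  have hl : (succ μ).IsRegular := isRegular_succ hμ.le
  have hl0 : ℵ₀ < succ μ := hμ.trans (lt_succ μ)
  -- Shelah's theorem needs a regular cofinality below μ⁺ other than cf μ; one of ω and ω₁ works
  -- because μ is uncountable.
  obtain ⟨θ, hθ, hθl, hθμ⟩ : ∃ θ : Cardinal.{u}, θ.IsRegular ∧ θ < succ μ ∧ θ ≠ μ.ord.cof := by
    by_cases h : μ.ord.cof = ℵ₀
    · refine ⟨succ ℵ₀, isRegular_succ le_rfl, lt_succ_of_le (succ_le_of_lt hμ), ?_⟩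
      rw [h]; exact (lt_succ _).ne'
    · exact ⟨ℵ₀, isRegular_aleph0, hl0, Ne.symm h⟩
  obtain ⟨d, hd⟩ := exists_diamond hμ.le hpow (S := {δ | δ.cof = θ})
    (fun D hD => by
      obtain ⟨τ, h1, h2, h3, -⟩ := hD.exists_cof hl hθ hθl
      exact ⟨τ, h3, h1, h2⟩)
    (fun δ hδ => by rw [show δ.cof = θ from hδ]; exact hθμ) hY
  refine ⟨fun δ β => d (otp (C δ)) (otp (C δ ∩ Set.Iio β)), fun γ hγ hcof f V hV => ?_⟩
  have hsub := hC.subset γ hγ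
  have hu := hC.unbdd γ hγ hV.isSuccLimit
  have htype : otp (C γ) = (succ μ).ord := by
    refine le_antisymm (hotp γ hγ) ?_
    rw [ord_le, ← hcof]
    exact card_otp_ge_cof hsub hu
  choose! x hx1 hx2 using fun o (ho : o < (succ μ).ord) =>
    exists_otp_inter_eq hsub (ho.trans_eq htype.symm)
  have hφ : ∀ y ∈ C γ, otp (C γ ∩ Set.Iio y) < (succ μ).ord := fun y hy =>
    (otp_inter_lt hsub hy).trans_eq htype
  have hxlt : ∀ y ∈ C γ, ∀ i < (succ μ).ord, y < x i ↔ otp (C γ ∩ Set.Iio y) < i := by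
    intro y hy i hi
    constructor
    · intro h
      have := otp_inter_lt_otp_inter hy h
      rwa [hx2 i hi] at this
    · intro h
      by_contra hc
      rcases (not_lt.1 hc).lt_or_eq with h1 | h1
      · have := otp_inter_lt_otp_inter (hx1 i hi) h1
        rw [hx2 i hi] at this
        exact lt_asymm h this
      · rw [← h1, hx2 i hi] at h
        exact lt_irrefl _ h
  have hxφ : ∀ y ∈ C γ, x (otp (C γ ∩ Set.Iio y)) = y := by
    intro y hy
    refine le_antisymm (not_lt.1 fun h => ?_) (not_lt.1 fun h => ?_)
    · exact lt_irrefl _ ((hxlt y hy _ (hφ y hy)).1 h)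
    · have := otp_inter_lt_otp_inter (hx1 _ (hφ y hy)) h
      rw [hx2 _ (hφ y hy)] at this
      exact lt_irrefl _ this
  have hmono : ∀ i j, i < j → j < (succ μ).ord → x i < x j := fun i j hij hj => by
    rw [hxlt _ (hx1 i (hij.trans hj)) j hj, hx2 i (hij.trans hj)]; exact hij
  -- At a closure point `j` of this function, `V` is unbounded below `x j`.
  have hg : ∀ i < (succ μ).ord, ∃ k < (succ μ).ord, ∃ v ∈ V, x i < v ∧ v < x k := by
    intro i hi
    obtain ⟨v, hv, h1, h2⟩ := hV.2 (x i) (hsub (hx1 i hi))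
    obtain ⟨y, hy, h3, -⟩ := hu.2 v h2
    exact ⟨_, hφ y hy, v, hv, h1, by rwa [hxφ y hy]⟩
  choose! g hg1 hg2 using hg
  obtain ⟨j, -, ⟨hjlim, hjg⟩, hj, hguess⟩ := hd (fun i => f (x i)) _
    (clubIn_closure_points hl hl0 g hg1)
  have hδγ : x j < γ := hsub (hx1 j hj)
  -- Continuity of the enumeration at limits: a supremum σ of earlier points strictly below `x j`
  -- would lie in the closed set `C γ`, hence have an index below `j` and be smaller than itself.
  have hCδ : UnbddBelow (C γ) (x j) := by
    by_contra hc
    have h0 : 0 < x j := (zero_le).trans_lt (hmono 0 j hjlim.bot_lt hj)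
    obtain ⟨x1, hx1j, hx1'⟩ := not_unbddBelow hc h0
    have hne : {z | ∀ i < j, x i < z}.Nonempty := ⟨x j, fun i hi => hmono i j hi hj⟩
    obtain ⟨σ, hσ⟩ : ∃ σ, σ = sInf {z | ∀ i < j, x i < z} := ⟨_, rfl⟩
    have hσ1 : ∀ i < j, x i < σ := hσ ▸ csInf_mem hne
    have hσ2 : σ ≤ x1 := by
      rw [hσ]
      refine csInf_le' fun i hi => ?_
      have h2 := hjlim.succ_lt hi
      have h3 := hmono i (succ i) (lt_succ i) (h2.trans hj)
      refine h3.trans_le ?_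
      by_contra h4
      exact absurd (hmono _ j h2 hj)
        (not_lt.2 (hx1' _ (hx1 _ (h2.trans hj)) (not_le.1 h4)))
    have hσu : UnbddBelow (C γ) σ := by
      refine ⟨(zero_le).trans_lt (hσ1 0 hjlim.bot_lt), fun y hy => ?_⟩
      have : ∃ i < j, y ≤ x i := by
        by_contra h4
        push Not at h4
        exact absurd (hσ ▸ csInf_le' h4 : σ ≤ y) (not_le.2 hy)
      obtain ⟨i, hi, h4⟩ := this
      have h2 := hjlim.succ_lt hi
      exact ⟨x (succ i), hx1 _ (h2.trans hj),
        h4.trans_lt (hmono i (succ i) (lt_succ i) (h2.trans hj)), hσ1 _ h2⟩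
    have hσj := hσ2.trans_lt hx1j
    have hσC := hC.closed γ hγ σ (hσj.trans hδγ) hσu
    have h5 := hσ1 _ ((hxlt σ hσC j hj).1 hσj)
    rw [hxφ σ hσC] at h5
    exact lt_irrefl _ h5
  have hco := hC.coherent γ hγ _ hδγ hCδ
  have hotpδ : otp (C (x j)) = j := by rw [hco]; exact hx2 j hj
  refine ⟨x j, hδγ, ⟨hCδ.1, fun y hy => ?_⟩, hCδ, ?_, fun β hβ hβj => ?_⟩
  · obtain ⟨z, hz, h1, h2⟩ := hCδ.2 y hy
    have h3 := (hxlt z hz j hj).1 h2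
    obtain ⟨v, hv, h4, h5⟩ := hg2 _ (h3.trans hj)
    rw [hxφ z hz] at h4
    exact ⟨v, hv, h1.trans h4, h5.trans (hmono _ j (hjg _ h3) hj)⟩
  · intro hc
    have h1 := card_otp_ge_cof (hC.subset (x j) (hδγ.trans hγ))
      (hC.unbdd _ (hδγ.trans hγ) hCδ.isSuccLimit)
    rw [hotpδ, hc] at h1
    exact absurd (lt_ord.1 hj) (not_lt.2 h1)
  · have h1 := (hxlt β hβ j hj).1 hβj
    have h2 : C (x j) ∩ Set.Iio β = C γ ∩ Set.Iio β := by
      rw [hco, Set.inter_assoc, Set.inter_eq_right.2 (Set.Iio_subset_Iio hβj.le)]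
    simp only [hotpδ, h2]
    rw [hguess _ h1, hxφ β hβ]

/-! ### The levels of the tree -/

section Code

variable {Λ : Type u} [Nonempty Λ]

open Classical in
/-- A coding function for a family of sets by elements of `Λ`, injective on the family whenever
this is possible. -/
noncomputable def code (𝒮 : Set (Set Ordinal.{u})) : Set Ordinal.{u} → Λ :=
  if h : ∃ g : Set Ordinal.{u} → Λ, Set.InjOn g 𝒮 then h.choose else fun _ => Classical.arbitrary Λ

theorem code_injOn {𝒮 : Set (Set Ordinal.{u})} (h : ∃ g : Set Ordinal.{u} → Λ, Set.InjOn g 𝒮) :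
    Set.InjOn (code (Λ := Λ) 𝒮) 𝒮 := by
  rw [code, dif_pos h]
  exact h.choose_spec

end Code

open Classical in
/-- A chosen element of a nonempty family. -/
noncomputable def pick (P : Set (Set Ordinal.{u})) : Set Ordinal.{u} :=
  if h : P.Nonempty then h.choose else ∅

theorem pick_mem {P : Set (Set Ordinal.{u})} (h : P.Nonempty) : pick P ∈ P := by
  rw [pick, dif_pos h]; exact h.choose_spec

/-- `b < β` are consecutive elements of `A`. -/
def Consec (A : Set Ordinal.{u}) (b β : Ordinal.{u}) : Prop :=
  b ∈ A ∧ β ∈ A ∧ b < β ∧ ∀ x ∈ A, x < β → x ≤ b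

/-- Successor points of the ladder have a predecessor. -/
theorem TailLadder.exists_consec {c : Ordinal.{u} → Set Ordinal.{u}} {K : Ordinal.{u}}
    (hc : TailLadder c K) {α β y : Ordinal.{u}} (hα : α < K) (hlim : IsSuccLimit α)
    (hβ : β ∈ c α) (hy : y ∈ c α) (hyβ : y < β) (h : ¬ UnbddBelow (c α) β) :
    ∃ b, y ≤ b ∧ Consec (c α) b β := by
  have hβα : β < α := hc.subset α hα hβ
  obtain ⟨x, hx, hx'⟩ := not_unbddBelow h ((zero_le).trans_lt hyβ)
  have hyx : y ≤ x := by
    by_contra hn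
    exact absurd (hx' y hy (not_le.1 hn)) (not_le.2 hyβ)
  have hle : supUpTo (c α) x < β := supUpTo_le.trans_lt hx
  have hmem : supUpTo (c α) x ∈ c α := by
    by_contra hn
    exact hn (hc.closed α hα hlim _ (hle.trans hβα)
      (unbddBelow_supUpTo ⟨y, hy, hyx⟩ hn))
  refine ⟨_, le_supUpTo hy hyx, hmem, hβ, hle, fun z hz hzβ => le_supUpTo hz ?_⟩
  by_contra hn
  exact absurd (hx' z hz (not_le.1 hn)) (not_le.2 hzβ)

theorem inter_Iio_inter_Iio (s : Set Ordinal.{u}) {a b : Ordinal.{u}} (h : a ≤ b) :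
    s ∩ Set.Iio b ∩ Set.Iio a = s ∩ Set.Iio a := by
  rw [Set.inter_assoc, Set.inter_eq_right.2 (Set.Iio_subset_Iio h)]

theorem eq_of_inter_Iio_eq {s t A : Set Ordinal.{u}} {α : Ordinal.{u}} (hs : s ⊆ Set.Iio α)
    (ht : t ⊆ Set.Iio α) (hA : UnbddBelow A α)
    (h : ∀ b ∈ A, b < α → s ∩ Set.Iio b = t ∩ Set.Iio b) : s = t := by
  ext x
  constructor
  · intro hx
    obtain ⟨b, hb, h1, h2⟩ := hA.2 x (hs hx)
    have : x ∈ t ∩ Set.Iio b := h b hb h2 ▸ ⟨hx, h1⟩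
    exact this.1
  · intro hx
    obtain ⟨b, hb, h1, h2⟩ := hA.2 x (ht hx)
    have : x ∈ s ∩ Set.Iio b := (h b hb h2).symm ▸ ⟨hx, h1⟩
    exact this.1

/-- The combinatorial data from which the tree is constructed. -/
structure TreeData (Λ : Type u) where
  /-- The ladder system along which branches are killed. -/
  C : Ordinal.{u} → Set Ordinal.{u}
  /-- The ladder system along which branches are protected. -/
  c : Ordinal.{u} → Set Ordinal.{u}
  /-- The guesses for maximal antichains. -/
  Ω : Ordinal.{u} → Ordinal.{u} → Set Λ
  /-- The guesses for branches. -/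
  d : Ordinal.{u} → Ordinal.{u} → Λ

namespace TreeData

variable {Λ : Type u} [Nonempty Λ] (p : TreeData Λ)

section Body

variable (T : Ordinal.{u} → Set (Set Ordinal.{u}))

/-- The nodes of level `β` that extend `u` of level `b`. -/
def extSet (b β : Ordinal.{u}) (u : Set Ordinal.{u}) : Set (Set Ordinal.{u}) :=
  {t ∈ T β | t ∩ Set.Iio b = u}

/-- The nodes of level `β` that extend `u` of level `b` and meet the guessed antichain. -/
def hitSet (b β : Ordinal.{u}) (u : Set Ordinal.{u}) : Set (Set Ordinal.{u}) :=
  {t ∈ T β | t ∩ Set.Iio b = u ∧ ∃ η < β, code (T η) (t ∩ Set.Iio η) ∈ p.Ω β η}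

open Classical in
/-- The canonical extension to level `β` of the node `u` of level `b`. -/
noncomputable def next (b β : Ordinal.{u}) (u : Set Ordinal.{u}) : Set Ordinal.{u} :=
  if (p.hitSet T b β u).Nonempty then pick (p.hitSet T b β u) else pick (extSet T b β u)

/-- The cofinal branches below level `α`. -/
def branches (α : Ordinal.{u}) : Set (Set Ordinal.{u}) :=
  {s | s ⊆ Set.Iio α ∧ ∀ β < α, s ∩ Set.Iio β ∈ T β}

/-- The branches that follow canonical extensions along the ladder at `α`. -/
def IsProtected (α : Ordinal.{u}) (s : Set Ordinal.{u}) : Prop :=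
  ∃ b₀ < α, ∀ b β, Consec (p.c α) b β → b₀ ≤ b →
    s ∩ Set.Iio β = p.next T b β (s ∩ Set.Iio b)

/-- The branch below `α` that is guessed. -/
def IsGuessed (α : Ordinal.{u}) (s : Set Ordinal.{u}) : Prop :=
  ∀ β ∈ p.C α, β < α → code (T β) (s ∩ Set.Iio β) = p.d α β

/-- The level `α`, in terms of the previous levels. -/
def levelBody (l : Cardinal.{u}) (α : Ordinal.{u}) : Set (Set Ordinal.{u}) :=
  {s ∈ branches T α | IsSuccLimit α → p.IsProtected T α s ∨ (α.cof ≠ l ∧ ¬ p.IsGuessed T α s)}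

variable {T}

/-- This makes the recursion in `lvl` legitimate: level α consults only smaller levels, so the
default ∅ used there from α on is harmless. -/
theorem levelBody_congr {T' : Ordinal.{u} → Set (Set Ordinal.{u})} (l : Cardinal.{u})
    {α : Ordinal.{u}} (hα : p.c α ⊆ Set.Iio α) (h : ∀ β < α, T β = T' β) :
    p.levelBody T l α = p.levelBody T' l α := by
  have h1 : ∀ s, s ∈ branches T α ↔ s ∈ branches T' α := by
    intro s
    refine and_congr_right fun _ => forall₂_congr fun β hβ => ?_
    rw [h β hβ]
  have h2 : ∀ s, p.IsGuessed T α s ↔ p.IsGuessed T' α s := by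
    intro s
    refine forall₂_congr fun β _ => forall_congr' fun hβ => ?_
    rw [h β hβ]
  have h3 : ∀ b β u, β < α → p.next T b β u = p.next T' b β u := by
    intro b β u hβ
    have h4 : p.hitSet T b β u = p.hitSet T' b β u := by
      ext t
      refine and_congr (by rw [h β hβ]) (and_congr_right fun _ => exists_congr fun η =>
        and_congr_right fun hη => by rw [h η (hη.trans hβ)])
    have h5 : extSet T b β u = extSet T' b β u := by
      ext t
      exact and_congr (by rw [h β hβ]) Iff.rfl
    rw [next, next, h4, h5]
  have h6 : ∀ s, p.IsProtected T α s ↔ p.IsProtected T' α s := by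
    intro s
    refine exists_congr fun b₀ => and_congr_right fun _ => forall₂_congr fun b β =>
      forall_congr' fun hb => ?_
    rw [h3 b β _ (hα hb.2.1)]
  ext s
  exact and_congr (h1 s) (forall_congr' fun _ => or_congr (h6 s)
    (and_congr_right fun _ => not_congr (h2 s)))

end Body

open Classical in
/-- The levels of the tree, as families of sets of ordinals. -/
noncomputable def lvl (l : Cardinal.{u}) : Ordinal.{u} → Set (Set Ordinal.{u}) :=
  WellFounded.fix (C := fun _ => Set (Set Ordinal.{u})) (wellFounded_lt (α := Ordinal.{u}))
    fun α T => p.levelBody (fun β => if h : β < α then T β h else ∅) l α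

theorem lvl_eq (l : Cardinal.{u}) {α : Ordinal.{u}} (hα : p.c α ⊆ Set.Iio α) :
    p.lvl l α = p.levelBody (p.lvl l) l α := by
  classical
  rw [lvl, WellFounded.fix_eq]
  exact p.levelBody_congr l hα fun β hβ => dif_pos hβ

/-- The properties of the data that are used in the construction of the tree. -/
structure Good (l : Cardinal.{u}) : Prop where
  mk_eq : #Λ = l
  aleph0_lt : ℵ₀ < l
  powerlt_eq : l ^< l = l
  ladder : Ladder p.C (succ l).ord
  tailLadder : TailLadder p.c (succ l).ord
  kill : ∀ γ < (succ l).ord, γ.cof = l → ∀ (f : Ordinal.{u} → Λ) (V : Set Ordinal.{u}),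
    UnbddBelow V γ → ∃ δ < γ, UnbddBelow V δ ∧ UnbddBelow (p.C γ) δ ∧ δ.cof ≠ l ∧
      ∀ β ∈ p.C γ, β < δ → p.d δ β = f β
  sealing : ∀ (f : Ordinal.{u} → Set Λ) (D : Set Ordinal.{u}), ClubIn D (succ l).ord →
    ∃ γ < (succ l).ord, γ.cof = l ∧
      UnbddBelow {β | β ∈ D ∧ IsNacc (p.c γ) β ∧ ∀ x < β, p.Ω β x = f x} γ

variable {p} {l : Cardinal.{u}} (hp : p.Good l)

/-! ### Canonical branches and extension of nodes. -/

section Levels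

theorem next_mem_extSet {b β : Ordinal.{u}} {u : Set Ordinal.{u}}
    (h : (extSet (p.lvl l) b β u).Nonempty) :
    p.next (p.lvl l) b β u ∈ extSet (p.lvl l) b β u := by
  rw [next]
  split_ifs with h1
  · exact ⟨(pick_mem h1).1, (pick_mem h1).2.1⟩
  · exact pick_mem h

include hp

theorem mem_lvl {α : Ordinal.{u}} (hα : α < (succ l).ord) {s : Set Ordinal.{u}} :
    s ∈ p.lvl l α ↔ s ∈ branches (p.lvl l) α ∧ (IsSuccLimit α →
      p.IsProtected (p.lvl l) α s ∨ (α.cof ≠ l ∧ ¬ p.IsGuessed (p.lvl l) α s)) := by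
  rw [p.lvl_eq l (hp.tailLadder.subset α hα)]; rfl

theorem subset_of_mem_lvl {α : Ordinal.{u}} (hα : α < (succ l).ord) {s : Set Ordinal.{u}}
    (hs : s ∈ p.lvl l α) : s ⊆ Set.Iio α := ((mem_lvl hp hα).1 hs).1.1

theorem inter_mem_lvl {α β : Ordinal.{u}} (hα : α < (succ l).ord) (hβ : β ≤ α)
    {s : Set Ordinal.{u}} (hs : s ∈ p.lvl l α) : s ∩ Set.Iio β ∈ p.lvl l β := by
  rcases hβ.lt_or_eq with h | rfl
  · exact ((mem_lvl hp hα).1 hs).1.2 β h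
  · rwa [Set.inter_eq_left.2 (subset_of_mem_lvl hp hα hs)]

/-- Two sets following canonical extensions agree if they agree at the beginning. -/
theorem canonical_unique {α y : Ordinal.{u}} (hα : α < (succ l).ord) (hlim : IsSuccLimit α)
    (hy : y ∈ p.c α) {s t : Set Ordinal.{u}} (hst : s ∩ Set.Iio y = t ∩ Set.Iio y)
    {β : Ordinal.{u}}
    (hs : ∀ b b', Consec (p.c α) b b' → y ≤ b → b' ≤ β →
      s ∩ Set.Iio b' = p.next (p.lvl l) b b' (s ∩ Set.Iio b))
    (ht : ∀ b b', Consec (p.c α) b b' → y ≤ b → b' ≤ β →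
      t ∩ Set.Iio b' = p.next (p.lvl l) b b' (t ∩ Set.Iio b))
    (a : Ordinal.{u}) : a ∈ p.c α → y ≤ a → a ≤ β → s ∩ Set.Iio a = t ∩ Set.Iio a := by
  induction a using WellFoundedLT.induction with
  | ind a ih =>
    intro ha hya haβ
    rcases hya.lt_or_eq with h | rfl
    · by_cases hu : UnbddBelow (p.c α) a
      · refine eq_of_inter_Iio_eq Set.inter_subset_right Set.inter_subset_right (hu.above h)
          fun b hb hba => ?_
        rw [inter_Iio_inter_Iio _ hba.le, inter_Iio_inter_Iio _ hba.le]
        exact ih b hba hb.1 (le_of_lt hb.2) (hba.le.trans haβ)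
      · obtain ⟨b, hyb, hb⟩ := hp.tailLadder.exists_consec hα hlim ha hy h hu
        rw [hs b a hb hyb haβ, ht b a hb hyb haβ, ih b hb.2.2.1 hb.1 hyb (hb.2.2.1.le.trans haβ)]
    · exact hst

/-- Apply `next` at successor points of the ladder and take unions at its limits, by induction on
ladder points. Admitting β = α as a final stage yields the cofinal branch itself, for which
membership in level α is not yet claimed. -/
theorem exists_canonical {α y : Ordinal.{u}} (hα : α < (succ l).ord) (hlim : IsSuccLimit α)
    (hnorm : ∀ β < α, ∀ b < β, ∀ x ∈ p.lvl l b, ∃ t ∈ p.lvl l β, t ∩ Set.Iio b = x)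
    (hy : y ∈ p.c α) {x : Set Ordinal.{u}} (hx : x ∈ p.lvl l y) (β : Ordinal.{u}) :
    β = α ∨ β ∈ p.c α → y ≤ β → ∃ s ∈ branches (p.lvl l) β, (β ≠ α → s ∈ p.lvl l β) ∧
      s ∩ Set.Iio y = x ∧ ∀ b b', Consec (p.c α) b b' → y ≤ b → b' ≤ β →
        s ∩ Set.Iio b' = p.next (p.lvl l) b b' (s ∩ Set.Iio b) := by
  have hsub := hp.tailLadder.subset α hα
  induction β using WellFoundedLT.induction with
  | ind β ih =>
    intro hβ hyβ
    have hβα : β ≤ α := by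
      rcases hβ with rfl | hβ
      · exact le_rfl
      · exact le_of_lt (hsub hβ)
    rcases hyβ.lt_or_eq with h | rfl
    · by_cases hu : UnbddBelow (p.c α) β
      · have ih' : ∀ b, b ∈ p.c α ∧ y ≤ b ∧ b < β → ∃ s, s ∈ p.lvl l b ∧
            s ∩ Set.Iio y = x ∧ ∀ a b', Consec (p.c α) a b' → y ≤ a → b' ≤ b →
              s ∩ Set.Iio b' = p.next (p.lvl l) a b' (s ∩ Set.Iio a) := by
          rintro b ⟨hb, hyb, hbβ⟩
          obtain ⟨s, -, h2, h3⟩ := ih b hbβ (Or.inr hb) hyb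
          exact ⟨s, h2 (ne_of_lt (hsub hb)), h3⟩
        choose! S hS1 hS2 hS3 using ih'
        have hcoh : ∀ b b', b ∈ p.c α → b' ∈ p.c α → y ≤ b → b ≤ b' → b' < β →
            S b' ∩ Set.Iio b = S b := by
          intro b b' hb hb' hyb hbb' hb'β
          have hb1 := And.intro hb (And.intro hyb (hbb'.trans_lt hb'β))
          have hb2 := And.intro hb' (And.intro (hyb.trans hbb') hb'β)
          have h4 := canonical_unique hp hα hlim hy (s := S b') (t := S b) (β := b)
            (by rw [hS2 b' hb2, hS2 b hb1])
            (fun a a' h1 h2 h3 => hS3 b' hb2 a a' h1 h2 (h3.trans hbb'))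
            (hS3 b hb1) b hb hyb le_rfl
          rw [h4, Set.inter_eq_left.2 (subset_of_mem_lvl hp ((hsub hb).trans hα) (hS1 b hb1))]
        let s : Set Ordinal.{u} := {z | ∃ b, (b ∈ p.c α ∧ y ≤ b ∧ b < β) ∧ z ∈ S b}
        have hs : ∀ b, b ∈ p.c α → y ≤ b → b < β → s ∩ Set.Iio b = S b := by
          intro b hb hyb hbβ
          ext z
          constructor
          · rintro ⟨⟨b', hb', hz⟩, hzb⟩
            rcases le_total b b' with h1 | h1
            · rw [← hcoh b b' hb hb'.1 hyb h1 hb'.2.2]; exact ⟨hz, hzb⟩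
            · have := hcoh b' b hb'.1 hb hb'.2.1 h1 hbβ
              rw [← this] at hz
              exact hz.1
          · intro hz
            exact ⟨⟨b, ⟨hb, hyb, hbβ⟩, hz⟩,
              subset_of_mem_lvl hp ((hsub hb).trans hα) (hS1 b ⟨hb, hyb, hbβ⟩) hz⟩
        have hbr : s ∈ branches (p.lvl l) β := by
          constructor
          · rintro z ⟨b, hb, hz⟩
            exact lt_trans (subset_of_mem_lvl hp ((hsub hb.1).trans hα) (hS1 b hb) hz) hb.2.2
          · intro b' hb'
            obtain ⟨b, hb, h1, h2⟩ := hu.2 (max b' y) (max_lt hb' h)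
            have hyb : y ≤ b := (le_max_right _ _).trans h1.le
            have hbb : b' ≤ b := (le_max_left _ _).trans h1.le
            rw [← inter_Iio_inter_Iio s hbb, hs b hb hyb h2]
            exact inter_mem_lvl hp ((hsub hb).trans hα) hbb (hS1 b ⟨hb, hyb, h2⟩)
        have hcan : ∀ b b', Consec (p.c α) b b' → y ≤ b → b' ≤ β →
            s ∩ Set.Iio b' = p.next (p.lvl l) b b' (s ∩ Set.Iio b) := by
          intro b b' hb hyb hb'β
          have hb'lt : b' < β := by
            refine hb'β.lt_of_ne ?_
            rintro rfl
            obtain ⟨z, hz, h1, h2⟩ := hu.2 b hb.2.2.1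
            exact absurd (hb.2.2.2 z hz h2) (not_le.2 h1)
          have hyb' := hyb.trans hb.2.2.1.le
          have hc1 := hS3 b' ⟨hb.2.1, hyb', hb'lt⟩ b b' hb hyb le_rfl
          rw [hs b' hb.2.1 hyb' hb'lt, hs b hb.1 hyb (hb.2.2.1.trans hb'lt)]
          rw [hcoh b b' hb.1 hb.2.1 hyb hb.2.2.1.le hb'lt] at hc1
          rw [← hc1, Set.inter_eq_left.2 (subset_of_mem_lvl hp ((hsub hb.2.1).trans hα)
            (hS1 b' ⟨hb.2.1, hyb', hb'lt⟩))]
        refine ⟨s, hbr, fun hne => ?_, ?_, hcan⟩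
        · have hβα' : β < α := hβα.lt_of_ne hne
          refine (mem_lvl hp (hβα'.trans hα)).2 ⟨hbr, fun hβlim => Or.inl ?_⟩
          -- Above ε the ladders at β and α have the same consecutive pairs, so the union is
          -- protected at β and is a node there.
          obtain ⟨ε, hε, hεiff⟩ := hp.tailLadder.tail α hα hlim β hβα' hu
          refine ⟨max (succ ε) y, max_lt (hβlim.succ_lt hε) h, fun b b' hb hle => ?_⟩
          have hεb : ε < b := (lt_succ ε).trans_le ((le_max_left _ _).trans hle)
          have hb'β : b' < β := hp.tailLadder.subset β (hβα'.trans hα) hb.2.1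
          refine hcan b b' ⟨(hεiff b hεb (hb.2.2.1.trans hb'β)).2 hb.1,
            (hεiff b' (hεb.trans hb.2.2.1) hb'β).2 hb.2.1, hb.2.2.1, fun z hz hzb => ?_⟩
            ((le_max_right _ _).trans hle) hb'β.le
          by_contra hc
          exact hc (hb.2.2.2 z ((hεiff z (hεb.trans (not_le.1 hc)) (hzb.trans hb'β)).1 hz) hzb)
        · rw [hs y hy le_rfl h]
          have := hS2 y ⟨hy, le_rfl, h⟩
          rwa [Set.inter_eq_left.2 (subset_of_mem_lvl hp ((hsub hy).trans hα)
            (hS1 y ⟨hy, le_rfl, h⟩))] at this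
      · have hβc : β ∈ p.c α := by
          rcases hβ with rfl | hβ
          · exact absurd (hp.tailLadder.unbdd β hα hlim) hu
          · exact hβ
        have hβα' : β < α := hsub hβc
        obtain ⟨b, hyb, hb⟩ := hp.tailLadder.exists_consec hα hlim hβc hy h hu
        obtain ⟨s, -, h2, h3, h4⟩ := ih b hb.2.2.1 (Or.inr hb.1) hyb
        have hsb : s ∈ p.lvl l b := h2 (ne_of_lt (hsub hb.1))
        have hss : s ∩ Set.Iio b = s :=
          Set.inter_eq_left.2 (subset_of_mem_lvl hp ((hsub hb.1).trans hα) hsb)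
        have hext : p.next (p.lvl l) b β s ∈ extSet (p.lvl l) b β s := by
          refine next_mem_extSet ?_
          obtain ⟨t, ht, ht'⟩ := hnorm β hβα' b hb.2.2.1 s hsb
          exact ⟨t, ht, ht'⟩
        have hmem := hext.1
        have hres := hext.2
        have hlow : ∀ a ≤ b, p.next (p.lvl l) b β s ∩ Set.Iio a = s ∩ Set.Iio a := by
          intro a ha
          rw [← inter_Iio_inter_Iio (p.next (p.lvl l) b β s) ha, hres]
        refine ⟨p.next (p.lvl l) b β s, ((mem_lvl hp (hβα'.trans hα)).1 hmem).1, fun _ => hmem, ?_,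
          fun a a' ha hya ha'β => ?_⟩
        · rw [hlow y hyb, h3]
        · rcases ha'β.lt_or_eq with h5 | rfl
          · have h6 : a' ≤ b := hb.2.2.2 a' ha.2.1 h5
            rw [hlow a' h6, hlow a (ha.2.2.1.le.trans h6)]
            exact h4 a a' ha hya h6
          · have h7 : a = b := le_antisymm (hb.2.2.2 a ha.1 ha.2.2.1) (ha.2.2.2 b hb.1 hb.2.2.1)
            subst h7
            rw [hres, Set.inter_eq_left.2 (subset_of_mem_lvl hp (hβα'.trans hα) hmem)]
    · have hyα : y < α := hsub hy
      refine ⟨x, ((mem_lvl hp (hyα.trans hα)).1 hx).1, fun _ => hx,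
        Set.inter_eq_left.2 (subset_of_mem_lvl hp (hyα.trans hα) hx), fun b b' hb hyb hb'y => ?_⟩
      exact absurd (hyb.trans_lt hb.2.2.1) (not_lt.2 hb'y)

/-- Every node extends to all higher levels. -/
theorem exists_extension (α : Ordinal.{u}) : α < (succ l).ord → ∀ b < α, ∀ x ∈ p.lvl l b,
    ∃ t ∈ p.lvl l α, t ∩ Set.Iio b = x := by
  induction α using WellFoundedLT.induction with
  | ind α ih =>
    intro hα b hb x hx
    by_cases hlim : IsSuccLimit α
    · obtain ⟨y, hy, h1, h2⟩ := (hp.tailLadder.unbdd α hα hlim).2 b hb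
      obtain ⟨x', hx', h3⟩ := ih y h2 (h2.trans hα) b h1 x hx
      obtain ⟨s, hs1, -, hs2, hs3⟩ := exists_canonical hp hα hlim
        (fun β hβ => ih β hβ (hβ.trans hα)) hy hx' α (Or.inl rfl) h2.le
      refine ⟨s, (mem_lvl hp hα).2 ⟨hs1, fun _ => Or.inl ⟨y, h2, fun a a' ha hya => ?_⟩⟩, ?_⟩
      · exact hs3 a a' ha hya (le_of_lt (hp.tailLadder.subset α hα ha.2.1))
      · rw [← inter_Iio_inter_Iio s h1.le, hs2, h3]
    · obtain ⟨β, rfl⟩ : ∃ β, α = succ β := by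
        rcases Ordinal.zero_or_succ_or_isSuccLimit α with h | ⟨β, h⟩ | h
        · exact absurd (h ▸ hb) not_lt_zero
        · exact ⟨β, by rw [← h]⟩
        · exact absurd h hlim
      have hβ : β < (succ l).ord := (lt_succ β).trans hα
      have key : ∀ t ∈ p.lvl l β, t ∈ p.lvl l (succ β) := by
        intro t ht
        have hsub := subset_of_mem_lvl hp hβ ht
        refine (mem_lvl hp hα).2 ⟨⟨hsub.trans (Set.Iio_subset_Iio (lt_succ β).le), fun a ha => ?_⟩,
          fun h => absurd h hlim⟩
        exact inter_mem_lvl hp hβ (le_of_lt_succ ha) ht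
      rcases (le_of_lt_succ hb).lt_or_eq with h | rfl
      · obtain ⟨t, ht, h'⟩ := ih β (lt_succ β) hβ b h x hx
        exact ⟨t, key t ht, h'⟩
      · exact ⟨x, key x hx, Set.inter_eq_left.2 (subset_of_mem_lvl hp hβ hx)⟩

theorem lvl_nonempty {α : Ordinal.{u}} (hα : α < (succ l).ord) : (p.lvl l α).Nonempty := by
  have h0 : (∅ : Set Ordinal.{u}) ∈ p.lvl l 0 := by
    refine (mem_lvl hp ((zero_le).trans_lt hα)).2 ⟨⟨Set.empty_subset _, fun β hβ => absurd hβ not_lt_zero⟩, fun h => ?_⟩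
    · exact absurd isMin_bot h.1
  rcases (zero_le (a := α)).lt_or_eq with h | rfl
  · obtain ⟨t, ht, -⟩ := exists_extension hp α hα 0 h _ h0
    exact ⟨t, ht⟩
  · exact ⟨_, h0⟩

/-- The nodes of level `α + 1`. -/
theorem mem_lvl_succ {β : Ordinal.{u}} (hβ : succ β < (succ l).ord) {s : Set Ordinal.{u}}
    (hs : s ⊆ Set.Iio (succ β)) (h : s ∩ Set.Iio β ∈ p.lvl l β) : s ∈ p.lvl l (succ β) := by
  refine (mem_lvl hp hβ).2 ⟨⟨hs, fun a ha => ?_⟩, fun hlim => ?_⟩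
  · rw [← inter_Iio_inter_Iio s (le_of_lt_succ ha)]
    exact inter_mem_lvl hp ((lt_succ β).trans hβ) (le_of_lt_succ ha) h
  · exact absurd (hlim.succ_lt (lt_succ β)) (lt_irrefl _)

end Levels

end TreeData

theorem exists_cofinal_family {α : Ordinal.{u}} (hα : IsSuccLimit α) :
    ∃ (ι : Type u) (f : ι → Ordinal.{u}), #ι = α.cof ∧ (∀ i, f i < α) ∧
      UnbddBelow (Set.range f) α := by
  obtain ⟨s, hs, hsc⟩ := Order.exists_cof_eq α.ToType
  rw [Ordinal.cof_toType] at hsc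
  refine ⟨s, fun i => toOrd i.1, hsc, fun i => toOrd_lt _, hα.bot_lt, fun x hx => ?_⟩
  obtain ⟨y, hy, hxy⟩ := hs (Ordinal.ToType.mk ⟨succ x, hα.succ_lt hx⟩)
  refine ⟨toOrd y, ⟨⟨y, hy⟩, rfl⟩, ?_, toOrd_lt y⟩
  have h2 : (⟨succ x, hα.succ_lt hx⟩ : Set.Iio α) ≤ Ordinal.ToType.mk.symm y := by
    rwa [OrderIso.le_symm_apply]
  exact (lt_succ x).trans_le h2

theorem exists_injOn_of_mk_le {Λ X : Type u} (h : #X ≤ #Λ) {𝒮 : Set (Set Ordinal.{u})}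
    (g : Set Ordinal.{u} → X) (hg : Set.InjOn g 𝒮) : ∃ g' : Set Ordinal.{u} → Λ, Set.InjOn g' 𝒮 := by
  obtain ⟨e⟩ := h
  exact ⟨fun s => e (g s), fun s hs t ht h => hg hs ht (e.injective h)⟩

/-! ### Protection at cofinality `l`, level sizes, fullness and sealing. -/

namespace TreeData

variable {Λ : Type u} [Nonempty Λ] {p : TreeData Λ} {l : Cardinal.{u}} (hp : p.Good l)

include hp

/-- At cofinality `l`, every branch follows canonical extensions. -/
theorem isProtected_of_cof_eq {γ : Ordinal.{u}} (hγ : γ < (succ l).ord) (hcof : γ.cof = l)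
    {s : Set Ordinal.{u}} (hs : s ∈ branches (p.lvl l) γ) : p.IsProtected (p.lvl l) γ s := by
  by_contra hc
  simp only [IsProtected, not_exists, not_and, not_forall] at hc
  have hlim : IsSuccLimit γ := 
    Ordinal.one_lt_cof_iff.1 (hcof ▸ one_lt_aleph0.trans hp.aleph0_lt)
  -- These are the upper ends of the steps at which `s` deviates from the canonical extension.
  have hV : UnbddBelow {b' | ∃ b, Consec (p.c γ) b b' ∧
      s ∩ Set.Iio b' ≠ p.next (p.lvl l) b b' (s ∩ Set.Iio b)} γ := by
    refine ⟨hlim.bot_lt, fun x hx => ?_⟩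
    obtain ⟨b, b', h1, h2, h3⟩ := hc x hx
    exact ⟨b', ⟨b, h1, h3⟩, h2.trans_lt h1.2.2.1, hp.tailLadder.subset γ hγ h1.2.1⟩
  obtain ⟨δ, hδ, hVδ, hCδ, hδc, hd⟩ := hp.kill γ hγ hcof
    (fun β => code (p.lvl l β) (s ∩ Set.Iio β)) _ hV
  have hδK := hδ.trans hγ
  rcases ((mem_lvl hp hδK).1 (hs.2 δ hδ)).2 hVδ.isSuccLimit with h | ⟨-, h⟩
  · obtain ⟨b₀, hb₀, hprot⟩ := h
    obtain ⟨ε, hε, htail⟩ := hp.tailLadder.tail γ hγ hlim δ hδ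
      (hVδ.mono fun x hx _ => hx.choose_spec.1.2.1)
    -- Two deviations are used: the lower end `b` of the second is at least `v`, so the whole step
    -- lies where the ladders at γ and δ agree and protection at δ is in force.
    obtain ⟨v, ⟨a, ha, -⟩, hv, hvδ⟩ := hVδ.2 (max ε b₀) (max_lt hε hb₀)
    obtain ⟨w, ⟨b, hb, hne⟩, hvw, hwδ⟩ := hVδ.2 v hvδ
    have hvb : v ≤ b := hb.2.2.2 v ha.2.1 hvw
    have hεb : ε < b := ((le_max_left _ _).trans_lt hv).trans_le hvb
    have := hprot b w ⟨(htail b hεb (hb.2.2.1.trans hwδ)).1 hb.1,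
      (htail w (hεb.trans hb.2.2.1) hwδ).1 hb.2.1, hb.2.2.1, fun z hz hzw => ?_⟩
      (((le_max_right _ _).trans_lt hv).trans_le hvb).le
    · rw [inter_Iio_inter_Iio s hwδ.le, inter_Iio_inter_Iio s (hb.2.2.1.trans hwδ).le] at this
      exact hne this
    · by_contra hn
      exact hn (hb.2.2.2 z ((htail z (hεb.trans (not_le.1 hn)) (hzw.trans hwδ)).2 hz) hzw)
  · refine h fun β hβ hβδ => ?_
    rw [hp.ladder.coherent γ hγ δ hδ hCδ] at hβ
    rw [inter_Iio_inter_Iio s hβδ.le, hd β hβ.1 hβδ]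

/-- Every level has at most `l` nodes. -/
theorem exists_injOn_lvl (α : Ordinal.{u}) : α < (succ l).ord →
    ∃ g : Set Ordinal.{u} → Λ, Set.InjOn g (p.lvl l α) := by
  induction α using WellFoundedLT.induction with
  | ind α ih =>
    intro hα
    have hinf : ℵ₀ ≤ #Λ := hp.mk_eq ▸ hp.aleph0_lt.le
    have hcode : ∀ β < α, Set.InjOn (code (Λ := Λ) (p.lvl l β)) (p.lvl l β) := fun β hβ =>
      code_injOn (ih β hβ (hβ.trans hα))
    have hcard : α.card ≤ l := lt_succ_iff.1 (lt_ord.1 hα)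
    rcases Ordinal.zero_or_succ_or_isSuccLimit α with rfl | ⟨β, rfl⟩ | hlim
    · refine ⟨fun _ => Classical.arbitrary Λ, fun s hs t ht _ => ?_⟩
      have h1 := subset_of_mem_lvl hp hα hs
      have h2 := subset_of_mem_lvl hp hα ht
      ext x
      exact ⟨fun hx => absurd (show x < 0 from h1 hx) not_lt_zero,
        fun hx => absurd (show x < 0 from h2 hx) not_lt_zero⟩
    · have hlt : β < β + 1 := lt_add_one β
      refine exists_injOn_of_mk_le (X := Λ × ULift.{u} Prop) ?_
        (fun s => (code (p.lvl l β) (s ∩ Set.Iio β), ⟨β ∈ s⟩)) fun s hs t ht h => ?_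
      · rw [mk_prod]
        simp only [Cardinal.lift_id, mk_uLift]
        refine mul_le_of_le hinf le_rfl ?_
        exact ((lt_aleph0_of_finite (ULift.{u} Prop)).le.trans' (by simp)).trans hinf
      · have h1 := hcode β hlt (inter_mem_lvl hp hα hlt.le hs) (inter_mem_lvl hp hα hlt.le ht)
          (congrArg Prod.fst h)
        have h2 : (β ∈ s) = (β ∈ t) := congrArg (fun z => z.2.down) h
        ext x
        have hx : ∀ r ∈ p.lvl l (β + 1), x ∈ r → x < β ∨ x = β := fun r hr hxr =>
          (lt_succ_iff.1 (subset_of_mem_lvl hp hα hr hxr)).lt_or_eq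
        constructor
        · intro hxs
          rcases hx s hs hxs with h3 | rfl
          · have : x ∈ t ∩ Set.Iio β := h1 ▸ ⟨hxs, h3⟩
            exact this.1
          · exact h2 ▸ hxs
        · intro hxs
          rcases hx t ht hxs with h3 | rfl
          · have : x ∈ s ∩ Set.Iio β := h1.symm ▸ ⟨hxs, h3⟩
            exact this.1
          · exact h2.symm ▸ hxs
    · by_cases hcof : α.cof = l
      -- A protected branch is determined by a ladder point where canonical behaviour has begun and
      -- its restriction there.
      · have hy : ∀ s, s ∈ p.lvl l α → ∃ y ∈ p.c α, y < α ∧ ∀ b b', Consec (p.c α) b b' → y ≤ b →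
            s ∩ Set.Iio b' = p.next (p.lvl l) b b' (s ∩ Set.Iio b) := by
          intro s hs
          obtain ⟨b₀, hb₀, h⟩ := isProtected_of_cof_eq hp hα hcof ((mem_lvl hp hα).1 hs).1
          obtain ⟨y, hy, h1, h2⟩ := (hp.tailLadder.unbdd α hα hlim).2 b₀ hb₀
          exact ⟨y, hy, h2, fun b b' hb hyb => h b b' hb (h1.le.trans hyb)⟩
        choose! y hy1 hy2 hy3 using hy
        classical
        have : Nonempty α.ToType := ⟨ofOrd 0 hlim.bot_lt⟩
        refine exists_injOn_of_mk_le (X := α.ToType × Λ) ?_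
          (fun s => (if h : y s < α then ofOrd (y s) h else Classical.arbitrary _,
            code (p.lvl l (y s)) (s ∩ Set.Iio (y s)))) fun s hs t ht h => ?_
        · rw [mk_prod]
          simp only [Cardinal.lift_id]
          exact mul_le_of_le hinf (by rw [mk_toType, hp.mk_eq]; exact hcard) le_rfl
        · have h1 := congrArg Prod.fst h
          have h2 := congrArg Prod.snd h
          simp only [dif_pos (hy2 s hs), dif_pos (hy2 t ht)] at h1 h2
          have h3 : y s = y t := by
            have := congrArg toOrd h1
            simpa using this
          rw [← h3] at h2
          have h4 := hcode _ (hy2 s hs) (inter_mem_lvl hp hα (hy2 s hs).le hs)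
            (inter_mem_lvl hp hα (hy2 s hs).le ht) h2
          refine eq_of_inter_Iio_eq (subset_of_mem_lvl hp hα hs) (subset_of_mem_lvl hp hα ht)
            ((hp.tailLadder.unbdd α hα hlim).above (hy2 s hs)) fun a ha haα => ?_
          exact canonical_unique hp hα hlim (hy1 s hs) h4 (β := α)
            (fun b b' hb hyb _ => hy3 s hs b b' hb hyb)
            (fun b b' hb hyb _ => hy3 t ht b b' hb (h3 ▸ hyb)) a ha.1 (le_of_lt ha.2) haα.le
      -- At other cofinalities, code a node by its restrictions to a cofinal set of levels; `l ^< l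
      -- = l` bounds the number of such sequences.
      · obtain ⟨ι, f, hι, hf, hfu⟩ := exists_cofinal_family hlim
        refine exists_injOn_of_mk_le (X := ι → Λ) ?_
          (fun s i => code (p.lvl l (f i)) (s ∩ Set.Iio (f i))) fun s hs t ht h => ?_
        · rw [← power_def, hp.mk_eq, hι]
          have hlt : α.cof < l := ((Ordinal.cof_le_card α).trans hcard).lt_of_ne hcof
          exact (le_powerlt l hlt).trans_eq hp.powerlt_eq
        · refine eq_of_inter_Iio_eq (subset_of_mem_lvl hp hα hs) (subset_of_mem_lvl hp hα ht)
            hfu ?_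
          rintro _ ⟨i, rfl⟩ hi
          exact hcode _ hi (inter_mem_lvl hp hα hi.le hs) (inter_mem_lvl hp hα hi.le ht)
            (congrFun h i)

theorem code_injOn_lvl {α : Ordinal.{u}} (hα : α < (succ l).ord) :
    Set.InjOn (code (Λ := Λ) (p.lvl l α)) (p.lvl l α) :=
  code_injOn (exists_injOn_lvl hp α hα)

/-- There is at most one branch without an upper bound at every limit level. -/
theorem branch_unique {α : Ordinal.{u}} (hα : α < (succ l).ord) (hlim : IsSuccLimit α)
    {s t : Set Ordinal.{u}} (hs : s ∈ branches (p.lvl l) α) (hs' : s ∉ p.lvl l α)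
    (ht : t ∈ branches (p.lvl l) α) (ht' : t ∉ p.lvl l α) : s = t := by
  have key : ∀ r ∈ branches (p.lvl l) α, r ∉ p.lvl l α → p.IsGuessed (p.lvl l) α r := by
    intro r hr hr'
    by_contra hg
    refine hr' ((mem_lvl hp hα).2 ⟨hr, fun _ => ?_⟩)
    by_cases hcof : α.cof = l
    · exact Or.inl (isProtected_of_cof_eq hp hα hcof hr)
    · exact Or.inr ⟨hcof, hg⟩
  refine eq_of_inter_Iio_eq hs.1 ht.1 (hp.ladder.unbdd α hα hlim) fun b hb hbα => ?_
  refine code_injOn_lvl hp (hbα.trans hα) (hs.2 b hbα) (ht.2 b hbα) ?_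
  rw [key s hs hs' b hb hbα, key t ht ht' b hb hbα]

theorem exists_bound_lvl {α : Ordinal.{u}} (hα : α < (succ l).ord) (F : Set Ordinal.{u} → Ordinal.{u})
    (hF : ∀ x ∈ p.lvl l α, F x < (succ l).ord) : ∃ b < (succ l).ord, ∀ x ∈ p.lvl l α, F x ≤ b := by
  classical
  have hreg : (succ l).IsRegular := isRegular_succ hp.aleph0_lt.le
  obtain ⟨b, hb, h⟩ := exists_bound (γ := (succ l).ord)
    (fun v : Λ => if h : ∃ x ∈ p.lvl l α, code (p.lvl l α) x = v then F h.choose else 0)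
    (by rw [hreg.cof_ord, hp.mk_eq]; exact lt_succ l) (fun v => by
      split_ifs with h
      · exact hF _ h.choose_spec.1
      · exact hreg.ord_pos)
  refine ⟨b, hb, fun x hx => ?_⟩
  have h1 : ∃ x' ∈ p.lvl l α, code (Λ := Λ) (p.lvl l α) x' = code (p.lvl l α) x := ⟨x, hx, rfl⟩
  have h2 := h (code (p.lvl l α) x)
  rw [dif_pos h1, code_injOn_lvl hp hα h1.choose_spec.1 hx h1.choose_spec.2] at h2
  exact h2

/-- Maximal antichains are bounded. -/
theorem exists_sealed (A : Ordinal.{u} → Set (Set Ordinal.{u}))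
    (hA : ∀ η < (succ l).ord, A η ⊆ p.lvl l η)
    (hmax : ∀ η < (succ l).ord, ∀ x ∈ p.lvl l η, ∃ η' < (succ l).ord, ∃ a ∈ A η',
      (η' ≤ η ∧ x ∩ Set.Iio η' = a) ∨ (η ≤ η' ∧ a ∩ Set.Iio η = x))
    (hanti : ∀ η < (succ l).ord, ∀ η' < (succ l).ord, ∀ a ∈ A η, ∀ a' ∈ A η', η ≤ η' →
      a' ∩ Set.Iio η = a → η = η') :
    ∃ γ < (succ l).ord, ∀ η, γ ≤ η → η < (succ l).ord → A η = ∅ := by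
  have hreg : (succ l).IsRegular := isRegular_succ hp.aleph0_lt.le
  choose! h hh1 hh2 using hmax
  choose! g hg1 hg2 using fun η (hη : η < (succ l).ord) =>
    exists_bound_lvl hp hη (h η) (hh1 η hη)
  obtain ⟨γ, hγ, hcof, hunb⟩ := hp.sealing (fun η => code (p.lvl l η) '' A η) _
    (clubIn_closure_points hreg (hp.aleph0_lt.trans (lt_succ l)) g hg1)
  refine ⟨γ, hγ, fun η hη hηK => Set.eq_empty_iff_forall_notMem.2 fun a ha => ?_⟩
  have hs : a ∩ Set.Iio γ ∈ branches (p.lvl l) γ :=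
    ((mem_lvl hp hγ).1 (inter_mem_lvl hp hηK hη (hA η hηK ha))).1
  have hlim := hunb.isSuccLimit
  obtain ⟨b₀, hb₀, hprot⟩ := isProtected_of_cof_eq hp hγ hcof hs
  obtain ⟨y, hy, hby, hyγ⟩ := (hp.tailLadder.unbdd γ hγ hlim).2 b₀ hb₀
  obtain ⟨β, ⟨⟨hβlim, hβcl⟩, ⟨hβc, x, hxβ, hx⟩, hΩ⟩, hyβ, hβγ⟩ := hunb.2 y hyγ
  obtain ⟨b, hyb, hb⟩ := hp.tailLadder.exists_consec hγ hlim hβc hy hyβ fun hu => by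
    obtain ⟨z, hz, h1, h2⟩ := hu.2 x hxβ
    exact absurd (hx z hz h1) (not_le.2 h2)
  have hbβ := hb.2.2.1
  have hβK := hβγ.trans hγ
  have hbK := hbβ.trans hβK
  have hnext := hprot b β hb (hby.le.trans hyb)
  rw [inter_Iio_inter_Iio a hβγ.le, inter_Iio_inter_Iio a (hbβ.trans hβγ).le] at hnext
  have haη := hA η hηK ha
  have hbη : b ≤ η := ((hbβ.trans hβγ).le).trans hη
  have hβη : β ≤ η := hβγ.le.trans hη
  have hxb := inter_mem_lvl hp hηK hbη haη
  -- The node of level `b` is comparable with some member of `A`, and closure of β under `g` puts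
  -- that member below level β, where `A` is guessed correctly.
  have hhit : (p.hitSet (p.lvl l) b β (a ∩ Set.Iio b)).Nonempty := by
    have hη' : h b (a ∩ Set.Iio b) < β := (hg2 b hbK _ hxb).trans_lt (hβcl b hbβ)
    obtain ⟨a', ha', h1 | h1⟩ := hh2 b hbK _ hxb
    · refine ⟨a ∩ Set.Iio β, inter_mem_lvl hp hηK hβη haη, inter_Iio_inter_Iio a hbβ.le,
        _, hη', ?_⟩
      rw [hΩ _ hη', inter_Iio_inter_Iio a hη'.le, ← inter_Iio_inter_Iio a h1.1, h1.2]
      exact ⟨a', ha', rfl⟩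
    · obtain ⟨t, ht, htr⟩ := exists_extension hp β hβK _ hη' a' (hA _ (hη'.trans hβK) ha')
      refine ⟨t, ht, ?_, _, hη', ?_⟩
      · rw [← inter_Iio_inter_Iio t h1.1, htr, h1.2]
      · rw [hΩ _ hη', htr]
        exact ⟨a', ha', rfl⟩
  -- Protection now forces the restriction of `a` to β to be an extension that meets `A` below β, so
  -- `a` lies strictly above a member of `A`.
  rw [next, if_pos hhit] at hnext
  obtain ⟨-, -, η₀, hη₀, hmem⟩ := pick_mem hhit
  rw [← hnext, hΩ _ hη₀, inter_Iio_inter_Iio a hη₀.le] at hmem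
  obtain ⟨a₀, ha₀, heq⟩ := hmem
  have hη₀K := hη₀.trans hβK
  have h1 := code_injOn_lvl hp hη₀K (hA _ hη₀K ha₀)
    (inter_mem_lvl hp hηK (hη₀.le.trans hβη) haη) heq
  have h2 := hanti η₀ hη₀K η hηK a₀ ha₀ a ha (hη₀.le.trans hβη) h1.symm
  exact absurd (hη₀.trans_le hβη) (by rw [h2]; exact lt_irrefl _)

end TreeData

/-! ### The tree of coded nodes as a partial order. -/

namespace TreeData

variable {Λ : Type u} [Nonempty Λ] (p : TreeData Λ) (l : Cardinal.{u})

/-- The nodes of the tree, given by their level and their code on that level. -/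
def Node : Type u :=
  {q : (succ l).ord.ToType × Λ // ∃ s ∈ p.lvl l (toOrd q.1), code (p.lvl l (toOrd q.1)) s = q.2}

variable {p l}

namespace Node

/-- The level of a node. -/
noncomputable def lev (x : p.Node l) : Ordinal.{u} := toOrd x.1.1

/-- The set of ordinals that a node stands for. -/
noncomputable def nd (x : p.Node l) : Set Ordinal.{u} := x.2.choose

theorem lev_lt (x : p.Node l) : x.lev < (succ l).ord := toOrd_lt _

theorem nd_mem (x : p.Node l) : x.nd ∈ p.lvl l x.lev := x.2.choose_spec.1

theorem code_nd (x : p.Node l) : code (p.lvl l x.lev) x.nd = x.1.2 := x.2.choose_spec.2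

theorem ext {x y : p.Node l} (h : x.lev = y.lev) (h' : x.nd = y.nd) : x = y := by
  have h1 : x.1.1 = y.1.1 := toOrd_injective h
  have h2 : x.1.2 = y.1.2 := by rw [← code_nd, ← code_nd, h, h']
  exact Subtype.ext (Prod.ext h1 h2)

instance : PartialOrder (p.Node l) where
  le x y := x = y ∨ (x.lev < y.lev ∧ y.nd ∩ Set.Iio x.lev = x.nd)
  lt x y := x.lev < y.lev ∧ y.nd ∩ Set.Iio x.lev = x.nd
  le_refl x := Or.inl rfl
  le_trans x y z := by
    rintro (rfl | ⟨h1, h2⟩) (rfl | ⟨h3, h4⟩)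
    · exact Or.inl rfl
    · exact Or.inr ⟨h3, h4⟩
    · exact Or.inr ⟨h1, h2⟩
    · exact Or.inr ⟨h1.trans h3, by rw [← inter_Iio_inter_Iio z.nd h1.le, h4, h2]⟩
  le_antisymm x y := by
    rintro (rfl | ⟨h1, h2⟩) (h | ⟨h3, h4⟩)
    · rfl
    · rfl
    · exact h.symm
    · exact absurd h1 h3.not_gt
  lt_iff_le_not_ge x y := by
    constructor
    · rintro ⟨h1, h2⟩
      refine ⟨Or.inr ⟨h1, h2⟩, ?_⟩
      rintro (rfl | ⟨h3, -⟩)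
      · exact lt_irrefl _ h1
      · exact absurd h1 h3.not_gt
    · rintro ⟨rfl | h, h'⟩
      · exact absurd (Or.inl rfl) h'
      · exact h

theorem lt_iff {x y : p.Node l} : x < y ↔ x.lev < y.lev ∧ y.nd ∩ Set.Iio x.lev = x.nd := Iff.rfl

theorem lev_lt_lev_iff {x y z : p.Node l} (hy : y < x) (hz : z < x) :
    y.lev < z.lev ↔ y < z := by
  refine ⟨fun h => ⟨h, ?_⟩, fun h => h.1⟩
  rw [← hz.2, inter_Iio_inter_Iio _ h.le, hy.2]

/-- The levels of the predecessors of a node. -/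
noncomputable def levEmbedding (x : p.Node l) :
    ((· < ·) : Set.Iio x → Set.Iio x → Prop) ↪r ((· < ·) : x.lev.ToType → x.lev.ToType → Prop) where
  toFun y := Ordinal.ToType.mk ⟨y.1.lev, (lt_iff.1 y.2).1⟩
  inj' y z h := by
    have h1 : y.1.lev = z.1.lev := by
      have h2 : toOrd (ofOrd y.1.lev (lt_iff.1 y.2).1) = toOrd (ofOrd z.1.lev (lt_iff.1 z.2).1) := congrArg toOrd h
      rwa [toOrd_ofOrd, toOrd_ofOrd] at h2
    refine Subtype.ext (ext h1 ?_)
    rw [← (lt_iff.1 y.2).2, ← (lt_iff.1 z.2).2, h1]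
  map_rel_iff' {y z} := by
    exact Ordinal.ToType.mk.lt_iff_lt.trans (lev_lt_lev_iff y.2 z.2)

instance : IsTree (p.Node l) := ⟨fun x => (levEmbedding x).isWellOrder⟩

variable (hp : p.Good l)

section

include hp

theorem le_iff {x y : p.Node l} : x ≤ y ↔ x.lev ≤ y.lev ∧ y.nd ∩ Set.Iio x.lev = x.nd := by
  constructor
  · rintro (rfl | ⟨h1, h2⟩)
    · exact ⟨le_rfl, Set.inter_eq_left.2 (subset_of_mem_lvl hp x.lev_lt x.nd_mem)⟩
    · exact ⟨h1.le, h2⟩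
  · rintro ⟨h1, h2⟩
    rcases h1.lt_or_eq with h | h
    · exact Or.inr ⟨h, h2⟩
    · refine Or.inl (ext h ?_)
      rw [← h2, h, Set.inter_eq_left.2 (subset_of_mem_lvl hp y.lev_lt y.nd_mem)]

/-- Sets of ordinals live one universe too high, so a node stores only a code; injectivity of the
code on its level ensures that the set chosen back is the intended one. -/
theorem exists_node {α : Ordinal.{u}} (hα : α < (succ l).ord) {s : Set Ordinal.{u}}
    (hs : s ∈ p.lvl l α) : ∃ x : p.Node l, x.lev = α ∧ x.nd = s := by
  have h1 : toOrd (ofOrd α hα) = α := toOrd_ofOrd α hα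
  let x : p.Node l := ⟨(ofOrd α hα, code (p.lvl l α) s), s, by rwa [h1], by rw [h1]⟩
  have hx : x.lev = α := h1
  refine ⟨x, hx, ?_⟩
  have h2 := x.nd_mem
  have h3 := x.code_nd
  rw [hx] at h2 h3
  exact code_injOn_lvl hp hα h2 hs h3

theorem height_eq_lev (x : p.Node l) : height x = x.lev := by
  have hsurj : Function.Surjective (levEmbedding x) := by
    intro a
    have ha : toOrd a < x.lev := toOrd_lt a
    obtain ⟨y, hy, hy'⟩ := exists_node hp (ha.trans x.lev_lt)
      (inter_mem_lvl hp x.lev_lt ha.le x.nd_mem)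
    have hlt : y < x := ⟨hy.symm ▸ ha, by rw [hy, hy']⟩
    refine ⟨⟨y, hlt⟩, toOrd_injective ?_⟩
    change toOrd (ofOrd y.lev hlt.1) = _
    rw [toOrd_ofOrd, hy]
  have h : IsWellOrder (Set.Iio x) (· < ·) := (levEmbedding x).isWellOrder
  have h1 := (RelIso.ofSurjective (levEmbedding x) hsurj).ordinalType_congr
  rw [Ordinal.type_toType] at h1
  exact h1

theorem mk_lev_lt {γ : Ordinal.{u}} (hγ : γ < (succ l).ord) : #{x : p.Node l | x.lev < γ} ≤ l := by
  have hinf := hp.aleph0_lt.le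
  have h : #{x : p.Node l | x.lev < γ} ≤ #(γ.ToType × Λ) := by
    refine mk_le_of_injective (f := fun x => (ofOrd x.1.lev x.2, x.1.1.2)) fun x y h => ?_
    obtain ⟨h1, h2⟩ := Prod.mk.inj h
    have h3 := congrArg toOrd h1
    rw [toOrd_ofOrd, toOrd_ofOrd] at h3
    exact Subtype.ext (Subtype.ext (Prod.ext (toOrd_injective h3) h2))
  refine h.trans ?_
  rw [mk_prod, Cardinal.lift_id, Cardinal.lift_id, mk_toType, hp.mk_eq]
  exact mul_le_of_le hinf (lt_succ_iff.1 (lt_ord.1 hγ)) le_rfl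

theorem isKappaTree : IsKappaTree (p.Node l) (succ l) where
  level_nonempty α hα := by
    obtain ⟨s, hs⟩ := lvl_nonempty hp hα
    obtain ⟨x, hx, -⟩ := exists_node hp hα hs
    exact ⟨x, (height_eq_lev hp x).trans hx⟩
  mk_level_lt α hα := by
    refine ((mk_le_mk_of_subset fun x hx => ?_).trans (mk_lev_lt hp
      ((isSuccLimit_ord_of_isRegular (isRegular_succ hp.aleph0_lt.le)).succ_lt hα))).trans_lt
      (lt_succ l)
    have : height x = α := hx
    rw [height_eq_lev hp] at this
    exact this ▸ lt_succ x.lev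
  level_ord_eq_empty := by
    refine Set.eq_empty_iff_forall_notMem.2 fun x hx => ?_
    have : height x = (succ l).ord := hx
    rw [height_eq_lev hp] at this
    exact x.lev_lt.ne this

/-- A branch, viewed as a set of ordinals. -/
theorem exists_set_of_isBranch {α : Ordinal.{u}} {B : Set (p.Node l)}
    (hB : IsBranch α B) : ∃ s ∈ branches (p.lvl l) α, ∀ x : p.Node l,
      x ∈ B ↔ x.lev < α ∧ s ∩ Set.Iio x.lev = x.nd := by
  have hlev : ∀ x ∈ B, x.lev < α := fun x hx => by
    have : height x ∈ Set.Iio α := hB.2 ▸ ⟨x, hx, rfl⟩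
    rwa [height_eq_lev hp] at this
  have hex : ∀ β < α, ∃ x ∈ B, x.lev = β := fun β hβ => by
    have : β ∈ height '' B := hB.2.symm ▸ hβ
    obtain ⟨x, hx, h⟩ := this
    exact ⟨x, hx, (height_eq_lev hp x).symm.trans h⟩
  have key : ∀ x ∈ B, (⋃ y ∈ B, y.nd) ∩ Set.Iio x.lev = x.nd := by
    intro x hx
    refine Set.Subset.antisymm ?_ fun z hz => ⟨Set.mem_iUnion₂.2 ⟨x, hx, hz⟩,
      subset_of_mem_lvl hp x.lev_lt x.nd_mem hz⟩
    rintro z ⟨hz, hzx⟩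
    obtain ⟨y, hy, hzy⟩ := Set.mem_iUnion₂.1 hz
    rcases hB.1.total hx hy with h | h
    · rw [← ((le_iff hp).1 h).2]
      exact ⟨hzy, hzx⟩
    · rw [← ((le_iff hp).1 h).2] at hzy
      exact hzy.1
  refine ⟨⋃ y ∈ B, y.nd, ⟨?_, fun β hβ => ?_⟩, fun x => ⟨fun hx => ⟨hlev x hx, key x hx⟩, ?_⟩⟩
  · refine Set.iUnion₂_subset fun y hy => ?_
    exact (subset_of_mem_lvl hp y.lev_lt y.nd_mem).trans (Set.Iio_subset_Iio (hlev y hy).le)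
  · obtain ⟨x, hx, rfl⟩ := hex β hβ
    rw [key x hx]
    exact x.nd_mem
  · rintro ⟨h1, h2⟩
    obtain ⟨y, hy, hyx⟩ := hex _ h1
    have : x = y := ext hyx.symm (by rw [← h2, ← key y hy, hyx])
    exact this ▸ hy

/-- If the union of a branch were in level α, the corresponding node would be an upper bound; so
vanishing branches come from omitted sets. -/
theorem isFull : IsFull (p.Node l) (succ l) := by
  intro α hα hlim B B' hB hBv hB' hBv'
  have key : ∀ (D : Set (p.Node l)) (s : Set Ordinal.{u}), IsVanishing D →
      (∀ x : p.Node l, x ∈ D ↔ x.lev < α ∧ s ∩ Set.Iio x.lev = x.nd) → s ∉ p.lvl l α := by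
    intro D s hD h hs
    obtain ⟨y, hy, hy'⟩ := exists_node hp hα hs
    exact hD ⟨y, fun x hx => (le_iff hp).2 ⟨hy.symm ▸ ((h x).1 hx).1.le, hy'.symm ▸ ((h x).1 hx).2⟩⟩
  obtain ⟨s, hs, h⟩ := exists_set_of_isBranch hp hB
  obtain ⟨s', hs', h'⟩ := exists_set_of_isBranch hp hB'
  obtain rfl := branch_unique hp hα hlim hs (key B s hBv h) hs' (key B' s' hBv' h')
  ext x
  rw [h, h']

/-- Enlarge the antichain to a maximal one by Zorn's lemma; sealing confines it to levels below some
γ < λ⁺, which together contain at most λ nodes. -/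
theorem mk_le_of_isAntichain {A : Set (p.Node l)} (hA : IsAntichain (· ≤ ·) A) : #A ≤ l := by
  obtain ⟨M, hAM, hM⟩ := zorn_subset_nonempty {M : Set (p.Node l) | IsAntichain (· ≤ ·) M}
    (fun c hc hchain _ => ⟨⋃₀ c, (Set.pairwise_sUnion hchain.directedOn).2 hc,
      fun _ => Set.subset_sUnion_of_mem⟩) A hA
  have hMa : IsAntichain (· ≤ ·) M := hM.prop
  obtain ⟨γ, hγ, h⟩ := exists_sealed hp (fun η => {s | ∃ x ∈ M, x.lev = η ∧ x.nd = s})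
    (by
      rintro η hη _ ⟨x, -, rfl, rfl⟩
      exact x.nd_mem)
    (by
      intro η hη s hs
      obtain ⟨x, rfl, rfl⟩ := exists_node hp hη hs
      by_cases hx : x ∈ M
      · exact ⟨x.lev, hη, x.nd, ⟨x, hx, rfl, rfl⟩, Or.inl ((le_iff hp).1 le_rfl)⟩
      · have h1 : ∃ a ∈ M, a ≤ x ∨ x ≤ a := by
          by_contra hc
          push Not at hc
          refine hx (hM.le_of_ge (y := insert x M) ?_ (Set.subset_insert x M)
            (Set.mem_insert x M))
          exact hMa.insert (fun a ha _ => (hc a ha).1) fun a ha _ => (hc a ha).2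
        obtain ⟨a, ha, h1⟩ := h1
        refine ⟨a.lev, a.lev_lt, a.nd, ⟨a, ha, rfl, rfl⟩, ?_⟩
        rwa [le_iff hp, le_iff hp] at h1)
    (by
      rintro η hη η' hη' _ ⟨x, hx, rfl, rfl⟩ _ ⟨y, hy, rfl, rfl⟩ hle h
      rw [hMa.eq hx hy ((le_iff hp).2 ⟨hle, h⟩)])
  refine (mk_le_mk_of_subset fun x hx => ?_).trans (mk_lev_lt hp hγ)
  by_contra hc
  have h1 : x.nd ∈ {s | ∃ y ∈ M, y.lev = x.lev ∧ y.nd = s} := ⟨x, hAM hx, rfl, rfl⟩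
  rw [h x.lev (not_lt.1 hc) x.lev_lt] at h1
  exact h1

/-- The nodes that leave a cofinal branch form a large antichain. -/
theorem not_isBranch_ord (B : Set (p.Node l)) : ¬ IsBranch (succ l).ord B := by
  intro hB
  obtain ⟨s, hs, -⟩ := exists_set_of_isBranch hp hB
  have hlim := isSuccLimit_ord_of_isRegular (isRegular_succ hp.aleph0_lt.le)
  have hex : ∀ a : (succ l).ord.ToType, ∃ x : p.Node l, x.lev = succ (toOrd a) ∧
      x.nd ∩ Set.Iio (toOrd a) = s ∩ Set.Iio (toOrd a) ∧ (toOrd a ∈ x.nd ↔ toOrd a ∉ s) := by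
    intro a
    set α := toOrd a with hα
    have hαK : α < (succ l).ord := toOrd_lt a
    -- The node follows the branch below α and takes the opposite decision about α itself.
    have h1 : (s ∩ Set.Iio α ∪ {z | z = α ∧ α ∉ s}) ∩ Set.Iio α = s ∩ Set.Iio α := by
      ext z
      constructor
      · rintro ⟨h | ⟨h, -⟩, h'⟩
        · exact h
        · exact absurd (show z < α from h') (by rw [show z = α from h]; exact lt_irrefl _)
      · exact fun h => ⟨Or.inl h, h.2⟩
    obtain ⟨x, hx, hx'⟩ := exists_node hp (hlim.succ_lt hαK)
      (mem_lvl_succ hp (hlim.succ_lt hαK) (s := s ∩ Set.Iio α ∪ {z | z = α ∧ α ∉ s}) (by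
        rintro z (h | ⟨h, -⟩)
        · exact lt_trans h.2 (lt_succ α)
        · exact (show z = α from h) ▸ lt_succ α) (by rw [h1]; exact hs.2 α hαK))
    refine ⟨x, hx, by rw [hx', h1], ?_⟩
    rw [hx']
    constructor
    · rintro (h | h)
      · exact absurd (show α < α from h.2) (lt_irrefl _)
      · exact h.2
    · exact fun h => Or.inr ⟨rfl, h⟩
  choose f hf1 hf2 hf3 using hex
  have hinj : Function.Injective f := fun a b h => by
    have := congrArg lev h
    rw [hf1, hf1] at this
    exact toOrd_injective (succ_injective this)
  have hanti : IsAntichain (· ≤ ·) (Set.range f) := by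
    rintro _ ⟨a, rfl⟩ _ ⟨b, rfl⟩ hne hle
    obtain ⟨h1, h2⟩ := (le_iff hp).1 hle
    rw [hf1, hf1, succ_le_succ_iff] at h1
    have hlt : toOrd a < toOrd b := h1.lt_of_ne fun h => hne (congrArg f (toOrd_injective h))
    have h3 : toOrd a ∈ (f a).nd ↔ toOrd a ∈ s := by
      rw [← h2, hf1]
      have h4 : toOrd a ∈ (f b).nd ∩ Set.Iio (toOrd b) ↔ toOrd a ∈ s ∩ Set.Iio (toOrd b) := by
        rw [hf2]
      simpa [hlt] using h4
    have := hf3 a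
    tauto
  have h := mk_le_of_isAntichain hp hanti
  rw [mk_range_eq f hinj, mk_toType, card_ord] at h
  exact absurd h (not_le.2 (lt_succ l))

theorem isSouslin : IsSouslin (p.Node l) (succ l) where
  no_branch := fun ⟨B, hB⟩ => not_isBranch_ord hp B hB
  no_antichain := fun ⟨_, hA, hmk⟩ =>
    absurd (mk_le_of_isAntichain hp hA) (not_le.2 (hmk ▸ lt_succ l))

end

end Node

end TreeData

/-! ### Assembling the combinatorial data. -/

theorem exists_good {l : Cardinal.{u}} (hsucc : ∃ m : Cardinal.{u}, ℵ₀ < m ∧ l = succ m)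
    (hpow : l ^< l = l) (hsquare : Square l) (hch : (2 : Cardinal.{u}) ^ l = succ l) :
    ∃ (Λ : Type u) (_ : Nonempty Λ) (p : TreeData Λ), p.Good l := by
  obtain ⟨μ, hμ, rfl⟩ := hsucc
  have hreg : (succ μ).IsRegular := isRegular_succ hμ.le
  have hl0 : ℵ₀ < succ μ := hμ.trans (lt_succ μ)
  -- The arithmetic hypothesis on μ⁺ gives 2^μ ≤ (μ⁺)^μ ≤ μ⁺, which is what Shelah's theorem
  -- requires on μ⁺.
  have h2 : (2 : Cardinal.{u}) ^ μ = succ μ := by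
    refine le_antisymm ?_ (succ_le_of_lt (cantor μ))
    calc (2 : Cardinal.{u}) ^ μ ≤ (succ μ) ^ μ :=
          power_le_power_right ((natCast_lt_aleph0 (n := 2)).trans hl0).le
      _ ≤ (succ μ) ^< (succ μ) := le_powerlt _ (lt_succ μ)
      _ = succ μ := hpow
  have hΛ : #((succ μ).ord.ToType) = succ μ := by rw [mk_toType, card_ord]
  have hne : Nonempty (succ μ).ord.ToType := by
    rw [← mk_ne_zero_iff, hΛ]
    exact (hreg.pos).ne'
  obtain ⟨C, hC, hotp⟩ := exists_ladder_of_square hsquare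
  obtain ⟨d, hd⟩ := exists_local_diamond hμ h2 hC hotp (Y := (succ μ).ord.ToType) (by rw [hΛ, h2])
  obtain ⟨c, Ω, hc, hΩ⟩ := exists_guessing_tailLadder hreg hl0 hch hC hotp
    (Y := Set (succ μ).ord.ToType) (by rw [mk_set, hΛ])
  exact ⟨_, hne, ⟨C, c, Ω, d⟩, ⟨hΛ, hl0, hpow, hC, hc, hd, hΩ⟩⟩

end FullSouslin

theorem theoremB (l : Cardinal.{u})
    (hsucc : ∃ m : Cardinal.{u}, Cardinal.aleph0 < m ∧ l = Order.succ m)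
    (hpow : Cardinal.powerlt l l = l)
    (hsquare : FullSouslin.Square l)
    (hch : (2 : Cardinal.{u}) ^ l = Order.succ l) :
    ∃ (T : Type u) (_ : PartialOrder T) (_ : FullSouslin.IsTree T),
      FullSouslin.IsKappaTree T (Order.succ l) ∧
      FullSouslin.IsFull T (Order.succ l) ∧
      FullSouslin.IsSouslin T (Order.succ l) := by
  obtain ⟨Λ, hΛ, p, hp⟩ := FullSouslin.exists_good hsucc hpow hsquare hch
  exact ⟨p.Node l, inferInstance, inferInstance, FullSouslin.TreeData.Node.isKappaTree hp,
    FullSouslin.TreeData.Node.isFull hp, FullSouslin.TreeData.Node.isSouslin hp⟩
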